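/- **Setting.** An *RGB tensor network* $T$ with $n$ input and $m$ output legs consists of finitely many elementary tensors over $\mathbb C^2$ and finitely many edges. Each edge has exactly two ends, and each end is either a leg of a tensor or one of the $n+m$ open ends. The elementary tensors, with legs labelled by bits $a,b,\dots$ and sign $s\in\{0,1\}$, are: - the blue spiders, with entry $(-1)^{sa}$ if all legs carry the same label $a$ and $0$ otherwise; - the red spiders $\delta_{a\oplus b\oplus\cdots,\,s}$; - the green spiders $i^{\pm a\pm b\pm\cdots}\,\delta_{a\oplus b\oplus\cdots,\,s}$, with the minus sign on flipped legs; - the basis transformations $H=\tfrac1{\sqrt2}(-1)^{ab}$, $S=\delta_{ab}i^a$ and $HS=\tfrac1{\sqrt2}i^{(1+2a)b}$. For a blue spider without legs the entry is read as $\sum_{a\in\{0,1\}}(-1)^{sa}$. Assume that the contraction $|T\rangle\in(\mathbb C^2)^{\otimes(n+m)}$ of $T$ is nonzero, and let $M_T:(\mathbb C^2)^{\otimes n}\to(\mathbb C^2)^{\otimes m}$ be the corresponding linear map. **Flows.** A *highlight* colors every edge and every sign with an element of $\{\text{trivial, red, green, blue}\}\cong\mathbb Z_2\times\mathbb Z_2$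 (red + blue = green), where red, green, blue stand for $X,Y,Z$. It is a *Pauli flow* if it is valid around every tensor. - Around a blue, red or green spider, the valid highlights are the sums of pairs of legs highlighted in the color of the spider and of the highlight of all legs and the sign in a second color (red for blue spiders, blue for red and green spiders). - A basis transformation has no sign, and the color of the second leg is determined by that of the first: $H$ interchanges red and blue and fixes green, $S$ interchanges red and green and fixes blue, and $HS$ maps red, green, blue to blue, red, green. Let $F(T)$ be the additive group of Pauli flows and $D(T)$ the subgroup of *detector flows*, which highlight all open legs trivially. **Sign.** For $f\in F(T)$ apply to every tensor the Paulis that $f$ prescribes on its legs; this multiplies the tensor by $\pm1$. On every contracted edge the two copies of the Pauli combine to $P^{\mathsf T}P=\pm1$; a wire joining two open legs contributes the sign in $(P\otimes P)\,\mathrm{wire}=\pm\,\mathrm{wire}$. On the open legs Paulis remain, with all remaining $Y$'s read in one fixed orientation, the same for all open legs (all as $Y$, or all as $Y^{\mathsf T}$). The product of all the signs is $c_f=\pm1$, and $\operatorname{sgn}(f)\in\{0,1\}$ is defined by $c_f=(-1)^{\operatorname{sgn}(f)}$. Let $\tilde p(f)$ be the Pauli word, with sign $+1$, that the highlight of the open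 legs gives, and let $\mathcal P_k$ be the $k$-qubit Pauli group (with phases $i^j$). **Theorem.** For either choice of orientation, the map $$p:F(T)/D(T)\to\mathcal P_{n+m},\qquad fD(T)\mapsto(-1)^{\operatorname{sgn}(f)}\,\tilde p(f)$$ is a well-defined injective group homomorphism, and $\mathcal S=\operatorname{Im}(p)$ is a stabilizer group: it is commutative and $-\mathbb 1\notin\mathcal S$. It has maximal rank, $|\mathcal S|=2^{n+m}$, and consists of exactly the $U\in\mathcal P_{n+m}$ that fix $|T\rangle$ (for the orientation $Y^{\mathsf T}$: such that $U^{\mathsf T}$ fixes $|T\rangle$). Let $\mathcal S_{\rm in}$ and $\mathcal S_{\rm out}$ be the subgroups of the elements of $\mathcal S$ of the form $a\otimes\mathbb 1$ and $\mathbb 1\otimes b$, respectively. There is a logical stabilizer group, i.e. a subgroup $\mathcal S_L\le\mathcal S$ that together with $\mathcal S_{\rm in}$ and $\mathcal S_{\rm out}$ generates $\mathcal S$ and meets $\langle\mathcal S_{\rm in},\mathcal S_{\rm out}\rangle$ only in $\mathbb 1$. For every such $\mathcal S_L$, multiplication is an isomorphism $\mathcal S_{\rm in}\times\mathcal S_{\rm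 out}\times\mathcal S_L\cong\mathcal S$, and every element of $\mathcal S_L$ other than $\mathbb 1$ acts nontrivially on both sides. Moreover, with $S_A=\{a\in\mathcal P_n: a\otimes\mathbb 1\in\mathcal S\}$, $S_B=\{b\in\mathcal P_m:\mathbb 1\otimes b\in\mathcal S\}$ and normalizers $N(\cdot)$ in the Pauli groups, $a\otimes b\in\mathcal S$ implies $a\in N(S_A)$ and $b\in N(S_B)$, and there is a group isomorphism (the logical isomorphism of the network) $$\varphi:N(S_A)/S_A\to N(S_B)/S_B$$ such that for all $a\in N(S_A)$ and $b\in N(S_B)$ $$\varphi(aS_A)=bS_B\iff a\otimes b\in\mathcal S\iff b\,M_T\,a^{\mathsf T}=M_T$$ (for the orientation $Y^{\mathsf T}$ the last condition reads $b^{\mathsf T}M_T\,a=M_T$). It is described by every logical stabilizer group $\mathcal S_L$: every class in $N(S_A)/S_A$ has the form $aS_A$ with $a\otimes b\in\mathcal S_L$ for some $a\in N(S_A)$, $b\in N(S_B)$, and then $\varphi(aS_A)=bS_B$. -/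

import Mathlib

/-! # RGB tensor networks, Pauli flows and the Pauli words they carry -/

namespace RGB

open scoped Kronecker Matrix

/-! ## Highlights of a leg and Pauli operators -/

/-- The four highlights of a leg or of a sign, as the group `ℤ₂ × ℤ₂`
(first entry: `X`-part, second entry: `Z`-part). The trivial highlight is `0`. -/
abbrev Color : Type := ZMod 2 × ZMod 2

/-- Red, the Pauli label `X`. -/
def red : Color := (1, 0)
/-- Blue, the Pauli label `Z`. -/
def blue : Color := (0, 1)
/-- Green, the Pauli label `Y`. -/
def green : Color := (1, 1)

/-- The Pauli matrix of a highlight: `1`, `X`, `Y`, `Z` for trivial, red, green, blue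
(the entries are spelled out in `pauliMatrix_zero`, …, `pauliMatrix_blue`).
The formula is `i ^ (ab) X ^ a Z ^ b`. -/
noncomputable def pauliMatrix (c : Color) : Matrix (ZMod 2) (ZMod 2) ℂ := fun x y =>
  if x = y + c.1 then Complex.I ^ (c.1.val * c.2.val) * (-1) ^ (c.2.val * y.val) else 0

theorem one_add_one : (1 : ZMod 2) + 1 = 0 := rfl

theorem zmod_univ : (Finset.univ : Finset (ZMod 2)) = {0, 1} := rfl

theorem pauliMatrix_zero : pauliMatrix 0 = 1 := by
  ext x y
  simp [pauliMatrix, Matrix.one_apply]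

theorem pauliMatrix_red : pauliMatrix red 0 0 = 0 ∧ pauliMatrix red 0 1 = 1 ∧
    pauliMatrix red 1 0 = 1 ∧ pauliMatrix red 1 1 = 0 := by
  simp [pauliMatrix, red, one_add_one]

theorem pauliMatrix_green : pauliMatrix green 0 0 = 0 ∧ pauliMatrix green 0 1 = -Complex.I ∧
    pauliMatrix green 1 0 = Complex.I ∧ pauliMatrix green 1 1 = 0 := by
  simp [pauliMatrix, green, ZMod.val_one, one_add_one]

theorem pauliMatrix_blue : pauliMatrix blue 0 0 = 1 ∧ pauliMatrix blue 0 1 = 0 ∧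
    pauliMatrix blue 1 0 = 0 ∧ pauliMatrix blue 1 1 = -1 := by
  simp [pauliMatrix, blue, ZMod.val_one]

theorem pauliMatrix_mul_self (c : Color) : pauliMatrix c * pauliMatrix c = 1 := by
  have key : ∀ a : ZMod 2, a = 0 ∨ a = 1 := by decide
  obtain ⟨a, b⟩ := c
  ext x z
  rcases key a with rfl | rfl <;> rcases key b with rfl | rfl <;>
    rcases key x with rfl | rfl <;> rcases key z with rfl | rfl <;>
    simp [Matrix.mul_apply, pauliMatrix, zmod_univ, ZMod.val_one, one_add_one]

/-- The Pauli word `⨂ᵢ P(wᵢ)`, as a matrix over the computational basis `ι → ZMod 2`. -/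
noncomputable def wordMatrix {ι : Type} [Fintype ι] (w : ι → Color) : Matrix (ι → ZMod 2) (ι → ZMod 2) ℂ :=
  fun x y => ∏ i, pauliMatrix (w i) (x i) (y i)

theorem wordMatrix_zero {ι : Type} [Fintype ι] : wordMatrix (0 : ι → Color) = 1 := by
  ext x y
  simp only [wordMatrix, Pi.zero_apply, pauliMatrix_zero, Matrix.one_apply]
  rw [Finset.prod_ite_zero]
  simp [funext_iff]

section Word

variable {ι : Type} [Fintype ι] [DecidableEq ι]

theorem wordMatrix_mul_self (w : ι → Color) : wordMatrix w * wordMatrix w = 1 := by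
  ext x z
  have h : ∀ i, ∑ y, pauliMatrix (w i) (x i) y * pauliMatrix (w i) y (z i)
      = if x i = z i then 1 else 0 := fun i => by
    rw [← Matrix.mul_apply, pauliMatrix_mul_self, Matrix.one_apply]
  simp only [Matrix.mul_apply, wordMatrix, ← Finset.prod_mul_distrib]
  rw [← Fintype.piFinset_univ, Finset.sum_prod_piFinset Finset.univ
    (fun i y => pauliMatrix (w i) (x i) y * pauliMatrix (w i) y (z i)), Finset.prod_congr rfl fun i _ => h i,
    Matrix.one_apply, Finset.prod_ite_zero]
  simp [funext_iff]

/-- The invertible operator `i ^ k ⨂ᵢ P(wᵢ)`. -/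
noncomputable def phasedWordUnit (k : ℕ) (w : ι → Color) :
    (Matrix (ι → ZMod 2) (ι → ZMod 2) ℂ)ˣ where
  val := Complex.I ^ k • wordMatrix w
  inv := (-Complex.I) ^ k • wordMatrix w
  val_inv := by
    rw [smul_mul_smul_comm, wordMatrix_mul_self, ← mul_pow]
    simp
  inv_val := by
    rw [smul_mul_smul_comm, wordMatrix_mul_self, ← mul_pow]
    simp

variable (ι) in
/-- The Pauli group on the qubits `ι`, a group of operators on `(ℂ²)^⊗ι`: it is generated by
(and in fact consists of) the words `i ^ k ⨂ᵢ Pᵢ` with `Pᵢ ∈ {1, X, Y, Z}`. -/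
def pauliSubgroup : Subgroup (Matrix (ι → ZMod 2) (ι → ZMod 2) ℂ)ˣ :=
  Subgroup.closure {U | ∃ (k : ℕ) (w : ι → Color), U = phasedWordUnit k w}

variable (ι) in
/-- The Pauli group `𝒫_ι` as a group. -/
abbrev PauliGroup : Type := pauliSubgroup ι

/-- The matrix of a Pauli operator. -/
def PauliGroup.mat (U : PauliGroup ι) : Matrix (ι → ZMod 2) (ι → ZMod 2) ℂ :=
  ((U : (Matrix (ι → ZMod 2) (ι → ZMod 2) ℂ)ˣ) : Matrix (ι → ZMod 2) (ι → ZMod 2) ℂ)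

/-- `i ^ k ⨂ᵢ P(wᵢ)` as an element of the Pauli group. -/
noncomputable def phasedWord (k : ℕ) (w : ι → Color) : PauliGroup ι :=
  ⟨phasedWordUnit k w, Subgroup.subset_closure ⟨k, w, rfl⟩⟩

/-- A stabilizer group: a commutative group of Pauli operators that does not contain `-1`. -/
def IsStabilizerGroup (S : Subgroup (PauliGroup ι)) : Prop :=
  (∀ U ∈ S, ∀ U' ∈ S, U * U' = U' * U) ∧ ∀ U ∈ S, U.mat ≠ -1

end Word

/-! ## Tensor products of Pauli operators on inputs and outputs -/

section Bipartition

variable {n m : ℕ}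

/-- `a ↦ a ⊗ 1`, from matrices on the input qubits to matrices on all qubits. -/
def matrixInl : Matrix (Fin n → ZMod 2) (Fin n → ZMod 2) ℂ →*
    Matrix (Fin n ⊕ Fin m → ZMod 2) (Fin n ⊕ Fin m → ZMod 2) ℂ where
  toFun a := (a ⊗ₖ (1 : Matrix (Fin m → ZMod 2) (Fin m → ZMod 2) ℂ)).submatrix
    (Equiv.sumArrowEquivProdArrow _ _ _) (Equiv.sumArrowEquivProdArrow _ _ _)
  map_one' := by simp
  map_mul' a b := by
    rw [Matrix.submatrix_mul_equiv, ← Matrix.mul_kronecker_mul, one_mul]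

/-- `b ↦ 1 ⊗ b`, from matrices on the output qubits to matrices on all qubits. -/
def matrixInr : Matrix (Fin m → ZMod 2) (Fin m → ZMod 2) ℂ →*
    Matrix (Fin n ⊕ Fin m → ZMod 2) (Fin n ⊕ Fin m → ZMod 2) ℂ where
  toFun b := ((1 : Matrix (Fin n → ZMod 2) (Fin n → ZMod 2) ℂ) ⊗ₖ b).submatrix
    (Equiv.sumArrowEquivProdArrow _ _ _) (Equiv.sumArrowEquivProdArrow _ _ _)
  map_one' := by simp
  map_mul' a b := by
    rw [Matrix.submatrix_mul_equiv, ← Matrix.mul_kronecker_mul, one_mul]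

theorem matrixInl_word (k : ℕ) (w : Fin n → Color) :
    Units.map (matrixInl (m := m)) (phasedWordUnit k w)
      = phasedWordUnit k (Sum.elim w 0) := by
  ext x y
  have h : (1 : Matrix (Fin m → ZMod 2) (Fin m → ZMod 2) ℂ) = wordMatrix 0 :=
    wordMatrix_zero.symm
  simp [matrixInl, phasedWordUnit, h, wordMatrix, mul_assoc]

theorem matrixInr_word (k : ℕ) (w : Fin m → Color) :
    Units.map (matrixInr (n := n)) (phasedWordUnit k w)
      = phasedWordUnit k (Sum.elim 0 w) := by
  ext x y
  have h : (1 : Matrix (Fin n → ZMod 2) (Fin n → ZMod 2) ℂ) = wordMatrix 0 :=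
    wordMatrix_zero.symm
  simp [matrixInr, phasedWordUnit, h, wordMatrix, mul_left_comm]

/-- The embedding `𝒫_n → 𝒫_{n+m}`, `a ↦ a ⊗ 1`. -/
def inputHom (n m : ℕ) : PauliGroup (Fin n) →* PauliGroup (Fin n ⊕ Fin m) :=
  ((Units.map (matrixInl (n := n) (m := m))).comp (pauliSubgroup (Fin n)).subtype).codRestrict
    (pauliSubgroup (Fin n ⊕ Fin m)) (by
      rintro ⟨U, hU⟩
      have h : (pauliSubgroup (Fin n)).map (Units.map (matrixInl (n := n) (m := m)))
          ≤ pauliSubgroup (Fin n ⊕ Fin m) := by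
        rw [pauliSubgroup, MonoidHom.map_closure, Subgroup.closure_le]
        rintro _ ⟨_, ⟨k, w, rfl⟩, rfl⟩
        exact Subgroup.subset_closure ⟨k, _, matrixInl_word k w⟩
      exact h ⟨U, hU, rfl⟩)

/-- The embedding `𝒫_m → 𝒫_{n+m}`, `b ↦ 1 ⊗ b`. -/
def outputHom (n m : ℕ) : PauliGroup (Fin m) →* PauliGroup (Fin n ⊕ Fin m) :=
  ((Units.map (matrixInr (n := n) (m := m))).comp (pauliSubgroup (Fin m)).subtype).codRestrict
    (pauliSubgroup (Fin n ⊕ Fin m)) (by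
      rintro ⟨U, hU⟩
      have h : (pauliSubgroup (Fin m)).map (Units.map (matrixInr (n := n) (m := m)))
          ≤ pauliSubgroup (Fin n ⊕ Fin m) := by
        rw [pauliSubgroup, MonoidHom.map_closure, Subgroup.closure_le]
        rintro _ ⟨_, ⟨k, w, rfl⟩, rfl⟩
        exact Subgroup.subset_closure ⟨k, _, matrixInr_word k w⟩
      exact h ⟨U, hU, rfl⟩)

/-- `a ⊗ b` for Pauli operators `a` on the inputs and `b` on the outputs. -/
def pauliTensor (a : PauliGroup (Fin n)) (b : PauliGroup (Fin m)) :
    PauliGroup (Fin n ⊕ Fin m) :=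
  inputHom n m a * outputHom n m b

/-- The input stabilizer group `𝒮_in ≤ 𝒫_{n+m}`: the elements of `S` of the form `a ⊗ 1`. -/
def inputPart (S : Subgroup (PauliGroup (Fin n ⊕ Fin m))) :
    Subgroup (PauliGroup (Fin n ⊕ Fin m)) := S ⊓ (inputHom n m).range

/-- The output stabilizer group `𝒮_out ≤ 𝒫_{n+m}`: the elements of `S` of the form `1 ⊗ b`. -/
def outputPart (S : Subgroup (PauliGroup (Fin n ⊕ Fin m))) :
    Subgroup (PauliGroup (Fin n ⊕ Fin m)) := S ⊓ (outputHom n m).range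

/-- `L` is a logical stabilizer group of `S`: a subgroup of `S` that together with the input and
output stabilizer groups generates `S`, and that shares with the group generated by the
operators in `S` acting trivially on one side only the identity. -/
def IsLogicalPart (S L : Subgroup (PauliGroup (Fin n ⊕ Fin m))) : Prop :=
  L ≤ S ∧ inputPart S ⊔ outputPart S ⊔ L = S ∧ L ⊓ (inputPart S ⊔ outputPart S) = ⊥

/-- `S_A = {a ∈ 𝒫_n | a ⊗ 1 ∈ S}`. -/
def inputStab (S : Subgroup (PauliGroup (Fin n ⊕ Fin m))) : Subgroup (PauliGroup (Fin n)) :=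
  S.comap (inputHom n m)

/-- `S_B = {b ∈ 𝒫_m | 1 ⊗ b ∈ S}`. -/
def outputStab (S : Subgroup (PauliGroup (Fin n ⊕ Fin m))) : Subgroup (PauliGroup (Fin m)) :=
  S.comap (outputHom n m)

end Bipartition

/-- The normalizer `N(S) = {p ∈ 𝒫 | p S = S p}` of a group of Pauli operators. -/
abbrev normalizerOf {ι : Type} [Fintype ι] [DecidableEq ι] (S : Subgroup (PauliGroup ι)) :
    Subgroup (PauliGroup ι) := Subgroup.normalizer (S : Set (PauliGroup ι))

/-- The logical Pauli group `N(S) / S` of the code stabilized by `S`. -/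
abbrev LogicalPauli {ι : Type} [Fintype ι] [DecidableEq ι] (S : Subgroup (PauliGroup ι)) : Type :=
  normalizerOf S ⧸ S.subgroupOf (normalizerOf S)

/-- The class in `N(S) / S` of an element of `N(S)`. -/
def logicalClass {ι : Type} [Fintype ι] [DecidableEq ι] {S : Subgroup (PauliGroup ι)}
    (x : normalizerOf S) : LogicalPauli S := QuotientGroup.mk x

/-! ## The elementary tensors -/

/-- The elementary building blocks, with `k` legs and sign label `s`. A leg `i` of a green
spider is flipped when `flip i` holds. -/
inductive Tensor : Type
  | blue (k : ℕ) (s : ZMod 2)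
  | red (k : ℕ) (s : ZMod 2)
  | green (k : ℕ) (s : ZMod 2) (flip : Fin k → Bool)
  | basisH
  | basisS
  | basisHS

namespace Tensor

/-- The number of legs. -/
def arity : Tensor → ℕ
  | blue k _ => k
  | red k _ => k
  | green k _ _ => k
  | basisH => 2
  | basisS => 2
  | basisHS => 2

/-- The entries `(-1) ^ (ab) / √2` of the tensor `H`. -/
noncomputable def hEntry (x : Fin 2 → ZMod 2) : ℂ :=
  1 / (Real.sqrt 2 : ℂ) * (-1) ^ ((x 0).val * (x 1).val)

/-- The entries `δ_{ab} i ^ a` of the tensor `S`. -/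
noncomputable def sEntry (x : Fin 2 → ZMod 2) : ℂ :=
  if x 0 = x 1 then Complex.I ^ (x 0).val else 0

/-- The entries `i ^ ((1 + 2a) b) / √2` of the tensor `HS`. -/
noncomputable def hsEntry (x : Fin 2 → ZMod 2) : ℂ :=
  1 / (Real.sqrt 2 : ℂ) * Complex.I ^ ((1 + 2 * (x 0).val) * (x 1).val)

/-- The entries of an elementary tensor in the computational basis. The sum for the blue
spider is `(-1) ^ (s a)` if all legs carry the same label `a`, and `0` otherwise. -/
noncomputable def entry : (t : Tensor) → (Fin t.arity → ZMod 2) → ℂ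
  | blue _ s, x => ∑ a : ZMod 2, if ∀ i, x i = a then (-1) ^ (s.val * a.val) else 0
  | red _ s, x => if ∑ i, x i = s then 1 else 0
  | green _ s flip, x =>
      if ∑ i, x i = s then
        ∏ i, (if flip i then -Complex.I else Complex.I) ^ (x i).val
      else 0
  | basisH, x => hEntry x
  | basisS, x => sEntry x
  | basisHS, x => hsEntry x

/-- A highlight `h` of the legs and `σ` of the sign around a spider of color `c` with
complementary color `c'` is valid if it is a sum of pairs of legs highlighted in `c` (an even
number of legs in total) and, if `b = 1`, of all legs and the sign highlighted in `c'`. -/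
def SpiderValid {k : ℕ} (c c' : Color) (h : Fin k → Color) (σ : Color) : Prop :=
  ∃ (b : ZMod 2) (e : Fin k → ZMod 2),
    ∑ i, e i = 0 ∧ (∀ i, h i = b • c' + e i • c) ∧ σ = b • c'

/-- A highlight around a basis transformation is valid if the color of leg `1` is the image of the
color of leg `0` under the permutation `g` of the colors; these tensors carry no sign. -/
def BasisValid (g : Color → Color) (h : Fin 2 → Color) (σ : Color) : Prop :=
  σ = 0 ∧ h 1 = g (h 0)

/-- The valid highlights around an elementary tensor (`h` on its legs, `σ` on its sign).
The basis transformations carry no sign; they interchange blue and red (`H`),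
green and red (`S`), or map red, green, blue on leg `0` to blue, red, green on leg `1` (`HS`). -/
def Valid : (t : Tensor) → (Fin t.arity → Color) → Color → Prop
  | blue _ _, h, σ => SpiderValid RGB.blue RGB.red h σ
  | red _ _, h, σ => SpiderValid RGB.red RGB.blue h σ
  | green _ _ _, h, σ => SpiderValid RGB.green RGB.blue h σ
  | basisH, h, σ => BasisValid (fun c => (c.2, c.1)) h σ
  | basisS, h, σ => BasisValid (fun c => (c.1, c.1 + c.2)) h σ
  | basisHS, h, σ => BasisValid (fun c => (c.2, c.1 + c.2)) h σ

theorem SpiderValid.add {k : ℕ} {c c' : Color} {h h' : Fin k → Color} {σ σ' : Color}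
    (H : SpiderValid c c' h σ) (H' : SpiderValid c c' h' σ') :
    SpiderValid c c' (h + h') (σ + σ') := by
  obtain ⟨b, e, h1, h2, h3⟩ := H
  obtain ⟨b', e', h1', h2', h3'⟩ := H'
  refine ⟨b + b', e + e', ?_, fun i => ?_, ?_⟩
  · simp [Finset.sum_add_distrib, h1, h1']
  · simp only [Pi.add_apply, h2, h2', add_smul]; abel
  · simp only [h3, h3', add_smul]

theorem SpiderValid.zero {k : ℕ} {c c' : Color} :
    SpiderValid c c' (0 : Fin k → Color) 0 := ⟨0, 0, by simp⟩

theorem BasisValid.add {g : Color → Color} (hg : ∀ c c', g (c + c') = g c + g c')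
    {h h' : Fin 2 → Color} {σ σ' : Color}
    (H : BasisValid g h σ) (H' : BasisValid g h' σ') : BasisValid g (h + h') (σ + σ') :=
  ⟨by rw [H.1, H'.1, add_zero], by rw [Pi.add_apply, Pi.add_apply, H.2, H'.2, hg]⟩

theorem Valid.zero : (t : Tensor) → t.Valid 0 0
  | blue _ _ => SpiderValid.zero
  | red _ _ => SpiderValid.zero
  | green _ _ _ => SpiderValid.zero
  | basisH => ⟨rfl, rfl⟩
  | basisS => ⟨rfl, rfl⟩
  | basisHS => ⟨rfl, rfl⟩

theorem Valid.add : (t : Tensor) → {h h' : Fin t.arity → Color} → {σ σ' : Color} →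
    t.Valid h σ → t.Valid h' σ' → t.Valid (h + h') (σ + σ')
  | blue _ _, _, _, _, _, H, H' => SpiderValid.add H H'
  | red _ _, _, _, _, _, H, H' => SpiderValid.add H H'
  | green _ _ _, _, _, _, _, H, H' => SpiderValid.add H H'
  | basisH, _, _, _, _, H, H' => BasisValid.add (g := fun c => (c.2, c.1)) (by decide) H H'
  | basisS, _, _, _, _, H, H' => BasisValid.add (g := fun c => (c.1, c.1 + c.2)) (by decide) H H'
  | basisHS, _, _, _, _, H, H' => BasisValid.add (g := fun c => (c.2, c.1 + c.2)) (by decide) H H'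

open Classical in
/-- The exponent `ε` of the projective symmetry `(⨂ᵢ P(hᵢ)) t = (-1) ^ ε t` of an elementary
tensor under a valid highlight `h` of its legs. -/
noncomputable def symmetrySign (t : Tensor) (h : Fin t.arity → Color) : ZMod 2 :=
  if wordMatrix h *ᵥ t.entry = t.entry then 0 else 1

end Tensor

/-! ## Networks -/

/-- An RGB tensor network with `n` input legs and `m` output legs: finitely many elementary
tensors and finitely many edges, each of which has exactly two ends; an end is a leg of a tensor
or one of the `n + m` open ends of the network. -/
structure Network (n m : ℕ) where
  /-- the tensors -/
  V : Type
  /-- the edges -/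
  E : Type
  [fintypeV : Fintype V]
  [fintypeE : Fintype E]
  [decEqE : DecidableEq E]
  /-- the elementary tensor at each vertex -/
  tensor : V → Tensor
  /-- the edge attached to a leg of a tensor -/
  legEdge : (v : V) → Fin (tensor v).arity → E
  /-- the edge that ends in an open leg; `Sum.inl` are the inputs, `Sum.inr` the outputs -/
  openEdge : Fin n ⊕ Fin m → E
  two_ends : ∀ e, Fintype.card {l : (v : V) × Fin (tensor v).arity // legEdge l.1 l.2 = e}
    + Fintype.card {i : Fin n ⊕ Fin m // openEdge i = e} = 2

attribute [instance] Network.fintypeV Network.fintypeE Network.decEqE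

namespace Network

variable {n m : ℕ} (T : Network n m)

/-- The tensor to which the network contracts, as a function of the labels of the open legs:
the sum over all labelings of the edges that extend the given labels. -/
noncomputable def eval : (Fin n ⊕ Fin m → ZMod 2) → ℂ := fun y =>
  ∑ x : T.E → ZMod 2,
    if (∀ i, x (T.openEdge i) = y i) then
      ∏ v, (T.tensor v).entry fun i => x (T.legEdge v i)
    else 0

/-- The linear map from inputs to outputs given by the contracted network. -/
noncomputable def linearMap : Matrix (Fin m → ZMod 2) (Fin n → ZMod 2) ℂ :=
  fun b a => T.eval (Sum.elim a b)

/-- Highlights: a color for each edge and for the sign of each tensor. -/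
abbrev Highlight : Type := (T.E → Color) × (T.V → Color)

/-- The group `F(T)` of Pauli flows: highlights that are valid around every tensor. -/
def flows : AddSubgroup T.Highlight where
  carrier := {f | ∀ v, (T.tensor v).Valid (fun i => f.1 (T.legEdge v i)) (f.2 v)}
  zero_mem' v := Tensor.Valid.zero _
  add_mem' hf hg v := Tensor.Valid.add _ (hf v) (hg v)
  neg_mem' {f} hf := by
    have h : -f = f := by ext <;> exact ZModModule.neg_eq_self _
    simpa only [h] using hf

/-- The restriction of a flow to the open legs. -/
def openColors (f : T.flows) : Fin n ⊕ Fin m → Color := fun i => f.1.1 (T.openEdge i)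

/-- The group `D(T)` of detector flows: no open leg is highlighted. -/
def detectorFlows : AddSubgroup T.flows where
  carrier := {f | ∀ i, T.openColors f i = 0}
  zero_mem' _ := rfl
  add_mem' {f g} hf hg i := by
    change T.openColors f i + T.openColors g i = 0
    rw [hf i, hg i, add_zero]
  neg_mem' {f} hf i := by
    change - T.openColors f i = 0
    rw [hf i, neg_zero]

/-- The number of open ends of an edge. -/
def openEnds (e : T.E) : ℕ := Fintype.card {i : Fin n ⊕ Fin m // T.openEdge i = e}

/-- The sign `sgn f ∈ {0, 1}` of a flow, where `(-1) ^ sgn f` is the prefactor `c_f` left over by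
looping `f`:

* applying the symmetry of `f` to each tensor gives the factor `(-1) ^ symmetrySign`;
* on a contracted edge the two copies of the highlighted Pauli `P` combine to `Pᵀ P`, which is
  `-1` if the edge is green and `1` otherwise; likewise a wire from open leg to open leg satisfies
  `(P ⊗ P) wire = ± wire` with the sign `-1` iff it is green;
* on an open leg attached to a tensor the Pauli remains, and the remaining green Paulis are read
  in a fixed orientation, the same for all open legs: as `Y` if `o = false`, and as
  `Yᵀ = -Y` if `o = true`, which costs one sign for each green open leg. -/
noncomputable def sgn (o : Bool) (f : T.flows) : ZMod 2 :=
  (∑ v, (T.tensor v).symmetrySign fun i => f.1.1 (T.legEdge v i))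
    + (∑ e, if f.1.1 e = green ∧ T.openEnds e ≠ 1 then 1 else 0)
    + (if o then ∑ i, if T.openColors f i = green then 1 else 0 else 0)

/-- The Pauli word with sign `+1` that the highlight of the open legs gives. -/
noncomputable def unsignedPauli (f : T.flows) : PauliGroup (Fin n ⊕ Fin m) :=
  phasedWord 0 (T.openColors f)

end Network

/-- A Pauli operator read in the chosen reference orientation of the open legs: `U` itself, or with
all tensor factors transposed. -/
def oriented {κ : Type} (o : Bool) (U : Matrix κ κ ℂ) : Matrix κ κ ℂ := if o then Uᵀ else U

end RGB

namespace RGB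

open scoped Kronecker Matrix

/-! ## Signs -/

theorem zmod_two_cases (a : ZMod 2) : a = 0 ∨ a = 1 := by
  revert a; decide

theorem zmod_add_self (a : ZMod 2) : a + a = 0 := CharTwo.add_self_eq_zero a

theorem neg_one_pow_val_add (s t : ZMod 2) :
    (-1 : ℂ) ^ (s + t).val = (-1) ^ s.val * (-1) ^ t.val := by
  rcases zmod_two_cases s with rfl | rfl <;> rcases zmod_two_cases t with rfl | rfl <;>
    simp [ZMod.val_one, one_add_one]

theorem neg_one_pow_val_sum {κ : Type*} (A : Finset κ) (s : κ → ZMod 2) :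
    (-1 : ℂ) ^ (∑ i ∈ A, s i).val = ∏ i ∈ A, (-1 : ℂ) ^ (s i).val := by
  classical
  induction A using Finset.induction_on with
  | empty => simp
  | insert a A ha ih => rw [Finset.sum_insert ha, Finset.prod_insert ha, neg_one_pow_val_add, ih]

theorem neg_one_pow_val_injective {s t : ZMod 2} (h : (-1 : ℂ) ^ s.val = (-1) ^ t.val) :
    s = t := by
  rcases zmod_two_cases s with rfl | rfl <;> rcases zmod_two_cases t with rfl | rfl
  · rfl
  · norm_num [ZMod.val_one] at h
  · norm_num [ZMod.val_one] at h
  · rfl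

theorem neg_one_pow_eq_I_pow (k : ℕ) : (-1 : ℂ) ^ k = Complex.I ^ (2 * k) := by
  rw [pow_mul, Complex.I_sq]

/-! ## Products of Pauli matrices and Pauli words -/

/-- The symplectic form on highlights: it vanishes iff the two Pauli matrices commute. -/
def symp (c d : Color) : ZMod 2 := c.1 * d.2 + c.2 * d.1

/-- `P(c) P(d) = i ^ mulPhase c d • P(c + d)`. -/
def mulPhase (c d : Color) : ℕ :=
  c.1.val * c.2.val + d.1.val * d.2.val + 2 * (c.2.val * d.1.val)
    + 3 * ((c.1 + d.1).val * (c.2 + d.2).val)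

theorem pauliMatrix_mul (c d : Color) :
    pauliMatrix c * pauliMatrix d = Complex.I ^ mulPhase c d • pauliMatrix (c + d) := by
  have h3 : Complex.I ^ 3 = -Complex.I := Complex.I_pow_three
  obtain ⟨a, b⟩ := c
  obtain ⟨a', b'⟩ := d
  ext x z
  rcases zmod_two_cases a with rfl | rfl <;> rcases zmod_two_cases b with rfl | rfl <;>
    rcases zmod_two_cases a' with rfl | rfl <;> rcases zmod_two_cases b' with rfl | rfl <;>
    rcases zmod_two_cases x with rfl | rfl <;> rcases zmod_two_cases z with rfl | rfl <;>
    simp [Matrix.mul_apply, pauliMatrix, zmod_univ, ZMod.val_one, one_add_one, mulPhase,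
      h3]

theorem pauliMatrix_mul_comm (c d : Color) :
    pauliMatrix c * pauliMatrix d
      = (-1 : ℂ) ^ (symp c d).val • (pauliMatrix d * pauliMatrix c) := by
  obtain ⟨a, b⟩ := c
  obtain ⟨a', b'⟩ := d
  ext x z
  rcases zmod_two_cases a with rfl | rfl <;> rcases zmod_two_cases b with rfl | rfl <;>
    rcases zmod_two_cases a' with rfl | rfl <;> rcases zmod_two_cases b' with rfl | rfl <;>
    rcases zmod_two_cases x with rfl | rfl <;> rcases zmod_two_cases z with rfl | rfl <;>
    simp [Matrix.mul_apply, pauliMatrix, zmod_univ, ZMod.val_one, one_add_one, symp]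

theorem pauliMatrix_transpose (c : Color) :
    (pauliMatrix c)ᵀ = (if c = green then (-1 : ℂ) else 1) • pauliMatrix c := by
  obtain ⟨a, b⟩ := c
  ext x z
  rcases zmod_two_cases a with rfl | rfl <;> rcases zmod_two_cases b with rfl | rfl <;>
    rcases zmod_two_cases x with rfl | rfl <;> rcases zmod_two_cases z with rfl | rfl <;>
    simp [pauliMatrix, ZMod.val_one, one_add_one, green]

/-- The nonzero entry of `P(c)` in the row `z`. -/
noncomputable def rowEntry (c : Color) (z : ZMod 2) : ℂ := pauliMatrix c z (z + c.1)

theorem rowEntry_sq (c : Color) (z : ZMod 2) :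
    rowEntry c z ^ 2 = if c = green then -1 else 1 := by
  obtain ⟨a, b⟩ := c
  rcases zmod_two_cases a with rfl | rfl <;> rcases zmod_two_cases b with rfl | rfl <;>
    rcases zmod_two_cases z with rfl | rfl <;>
    simp [rowEntry, pauliMatrix, ZMod.val_one, one_add_one, green]

theorem pauliMatrix_apply (c : Color) (z y : ZMod 2) :
    pauliMatrix c z y = if y = z + c.1 then rowEntry c z else 0 := by
  by_cases h : y = z + c.1
  · rw [if_pos h, h, rowEntry]
  · rw [if_neg h, pauliMatrix, if_neg]
    rintro rfl
    exact h (by rw [add_assoc, zmod_add_self, add_zero])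

section Word

variable {ι : Type} [Fintype ι]

theorem wordMatrix_mulVec [DecidableEq ι] (w : ι → Color) (v : (ι → ZMod 2) → ℂ)
    (z : ι → ZMod 2) :
    (wordMatrix w *ᵥ v) z = (∏ i, rowEntry (w i) (z i)) * v fun i => z i + (w i).1 := by
  rw [Matrix.mulVec, dotProduct, Finset.sum_eq_single fun i => z i + (w i).1]
  · rfl
  · intro y _ hy
    obtain ⟨i, hi⟩ := Function.ne_iff.1 hy
    rw [wordMatrix, Finset.prod_eq_zero (Finset.mem_univ i), zero_mul]
    rw [pauliMatrix_apply, if_neg hi]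
  · simp

/-- The symplectic form on Pauli words. -/
def wordForm (ι : Type) [Fintype ι] : LinearMap.BilinForm (ZMod 2) (ι → Color) :=
  LinearMap.mk₂ (ZMod 2) (fun w w' => ∑ i, symp (w i) (w' i))
    (fun a b c => by
      rw [← Finset.sum_add_distrib]
      refine Finset.sum_congr rfl fun i _ => ?_
      simp only [symp, Pi.add_apply, Prod.fst_add, Prod.snd_add]
      ring)
    (fun r a b => by
      rw [smul_eq_mul, Finset.mul_sum]
      refine Finset.sum_congr rfl fun i _ => ?_
      simp only [symp, Pi.smul_apply, Prod.smul_fst, Prod.smul_snd, smul_eq_mul]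
      ring)
    (fun a b c => by
      rw [← Finset.sum_add_distrib]
      refine Finset.sum_congr rfl fun i _ => ?_
      simp only [symp, Pi.add_apply, Prod.fst_add, Prod.snd_add]
      ring)
    (fun r a b => by
      rw [smul_eq_mul, Finset.mul_sum]
      refine Finset.sum_congr rfl fun i _ => ?_
      simp only [symp, Pi.smul_apply, Prod.smul_fst, Prod.smul_snd, smul_eq_mul]
      ring)

theorem wordForm_apply (w w' : ι → Color) : wordForm ι w w' = ∑ i, symp (w i) (w' i) := rfl

theorem wordForm_isSymm : (wordForm ι).IsSymm :=
  ⟨fun w w' => by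
    rw [wordForm_apply, wordForm_apply]
    refine Finset.sum_congr rfl fun i _ => ?_
    simp only [symp]
    ring⟩

theorem wordMatrix_transpose (w : ι → Color) :
    (wordMatrix w)ᵀ = (-1 : ℂ) ^ (∑ i, if w i = green then (1 : ZMod 2) else 0).val
      • wordMatrix w := by
  ext x y
  rw [Matrix.transpose_apply, Matrix.smul_apply, neg_one_pow_val_sum, smul_eq_mul, wordMatrix,
    wordMatrix, ← Finset.prod_mul_distrib]
  refine Finset.prod_congr rfl fun i _ => ?_
  rw [← Matrix.transpose_apply (pauliMatrix (w i)), pauliMatrix_transpose, Matrix.smul_apply,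
    smul_eq_mul]
  split_ifs <;> simp [ZMod.val_one]

variable [DecidableEq ι]

theorem wordMatrix_mul_apply (w w' : ι → Color) (x z : ι → ZMod 2) :
    (wordMatrix w * wordMatrix w') x z
      = ∏ i, (pauliMatrix (w i) * pauliMatrix (w' i)) (x i) (z i) := by
  simp only [Matrix.mul_apply, wordMatrix, ← Finset.prod_mul_distrib]
  rw [← Fintype.piFinset_univ, Finset.sum_prod_piFinset Finset.univ
    (fun i y => pauliMatrix (w i) (x i) y * pauliMatrix (w' i) y (z i))]

theorem wordMatrix_mul (w w' : ι → Color) :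
    wordMatrix w * wordMatrix w'
      = Complex.I ^ (∑ i, mulPhase (w i) (w' i)) • wordMatrix (w + w') := by
  ext x z
  rw [wordMatrix_mul_apply]
  simp only [pauliMatrix_mul, Matrix.smul_apply, smul_eq_mul, Finset.prod_mul_distrib,
    Finset.prod_pow_eq_pow_sum]
  rfl

theorem wordForm_single (w : ι → Color) (i : ι) (c : Color) :
    wordForm ι w (Pi.single i c) = symp (w i) c := by
  rw [wordForm_apply, Finset.sum_eq_single i]
  · simp
  · intro j _ hj
    simp [Pi.single_eq_of_ne hj, symp]
  · simp

theorem eq_of_wordForm_eq {w w' : ι → Color} (h : ∀ u, wordForm ι w u = wordForm ι w' u) :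
    w = w' := by
  have key : ∀ c d : Color, (∀ e, symp c e = symp d e) → c = d := by decide
  funext i
  refine key _ _ fun e => ?_
  rw [← wordForm_single, ← wordForm_single, h]

theorem wordForm_nondegenerate : (wordForm ι).Nondegenerate := by
  refine (LinearMap.IsRefl.nondegenerate_iff_separatingLeft wordForm_isSymm.isRefl).2 fun w h => ?_
  exact eq_of_wordForm_eq fun u => by rw [h u, map_zero, LinearMap.zero_apply]

theorem wordMatrix_mul_comm (w w' : ι → Color) :
    wordMatrix w * wordMatrix w'
      = (-1 : ℂ) ^ (wordForm ι w w').val • (wordMatrix w' * wordMatrix w) := by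
  ext x z
  rw [Matrix.smul_apply, wordMatrix_mul_apply, wordMatrix_mul_apply, wordForm_apply,
    neg_one_pow_val_sum, smul_eq_mul, ← Finset.prod_mul_distrib]
  exact Finset.prod_congr rfl fun i _ => by
    rw [pauliMatrix_mul_comm, Matrix.smul_apply, smul_eq_mul]

theorem wordMatrix_mul_ne_zero (w w' : ι → Color) : wordMatrix w * wordMatrix w' ≠ 0 := by
  intro h
  have h1 : wordMatrix w * (wordMatrix w * wordMatrix w') * wordMatrix w' = 1 := by
    rw [← mul_assoc, wordMatrix_mul_self, one_mul, wordMatrix_mul_self]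
  rw [h, mul_zero, zero_mul] at h1
  exact zero_ne_one h1

theorem word_eq_of_proportional {w w' : ι → Color} {c : ℂ}
    (h : wordMatrix w = c • wordMatrix w') : w = w' := by
  refine eq_of_wordForm_eq fun u => neg_one_pow_val_injective ?_
  have h1 := wordMatrix_mul_comm w u
  have h2 : wordMatrix w * wordMatrix u
      = (-1 : ℂ) ^ (wordForm ι w' u).val • (wordMatrix u * wordMatrix w) := by
    rw [h, smul_mul_assoc, wordMatrix_mul_comm w' u, mul_smul_comm, smul_comm]
  exact smul_left_injective ℂ (wordMatrix_mul_ne_zero u w) (h1.symm.trans h2)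

/-! ## The Pauli group -/

theorem PauliGroup.mat_injective : Function.Injective (PauliGroup.mat (ι := ι)) :=
  fun _ _ h => Subtype.ext (Units.ext h)

@[simp] theorem PauliGroup.mat_one : (1 : PauliGroup ι).mat = 1 := rfl

@[simp] theorem PauliGroup.mat_mul (U U' : PauliGroup ι) : (U * U').mat = U.mat * U'.mat := rfl

@[simp] theorem mat_phasedWord (k : ℕ) (w : ι → Color) :
    (phasedWord k w).mat = Complex.I ^ k • wordMatrix w := rfl

theorem phasedWord_zero_zero : phasedWord 0 (0 : ι → Color) = 1 :=
  PauliGroup.mat_injective (by simp [wordMatrix_zero])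

theorem phasedWord_mul (k k' : ℕ) (w w' : ι → Color) :
    phasedWord k w * phasedWord k' w'
      = phasedWord (k + k' + ∑ i, mulPhase (w i) (w' i)) (w + w') :=
  PauliGroup.mat_injective (by
    simp only [PauliGroup.mat_mul, mat_phasedWord, smul_mul_smul_comm, wordMatrix_mul, smul_smul,
      pow_add])

theorem phasedWord_inv (k : ℕ) (w : ι → Color) :
    (phasedWord k w)⁻¹ = phasedWord (3 * k) w := by
  refine inv_eq_of_mul_eq_one_right (PauliGroup.mat_injective ?_)
  rw [PauliGroup.mat_mul, mat_phasedWord, mat_phasedWord, smul_mul_smul_comm,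
    wordMatrix_mul_self, ← pow_add, show k + 3 * k = 4 * k by ring, pow_mul]
  simp

theorem exists_eq_phasedWord (U : PauliGroup ι) : ∃ k w, U = phasedWord k w := by
  obtain ⟨U, hU⟩ := U
  have key : ∀ V (hV : V ∈ pauliSubgroup ι),
      ∃ k w, (⟨V, hV⟩ : PauliGroup ι) = phasedWord k w := by
    intro V hV
    induction hV using Subgroup.closure_induction with
    | mem V h =>
      obtain ⟨k, w, rfl⟩ := h
      exact ⟨k, w, rfl⟩
    | one => exact ⟨0, 0, phasedWord_zero_zero.symm⟩
    | mul x y hx hy ihx ihy =>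
      obtain ⟨k, w, h⟩ := ihx
      obtain ⟨k', w', h'⟩ := ihy
      exact ⟨_, _, (congrArg₂ (· * ·) h h').trans (phasedWord_mul k k' w w')⟩
    | inv x hx ih =>
      obtain ⟨k, w, h⟩ := ih
      exact ⟨_, _, (congrArg (·⁻¹) h).trans (phasedWord_inv k w)⟩
  exact key U hU

theorem phasedWord_injective_right {k k' : ℕ} {w w' : ι → Color}
    (h : phasedWord k w = phasedWord k' w') : w = w' := by
  refine word_eq_of_proportional (c := (-Complex.I) ^ k * Complex.I ^ k') ?_
  have h1 := congrArg PauliGroup.mat h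
  rw [mat_phasedWord, mat_phasedWord] at h1
  rw [mul_smul, ← h1, smul_smul, ← mul_pow]
  simp

/-- The unsigned Pauli word underlying a Pauli operator. -/
noncomputable def PauliGroup.word (U : PauliGroup ι) : ι → Color :=
  (exists_eq_phasedWord U).choose_spec.choose

theorem exists_eq_phasedWord_word (U : PauliGroup ι) : ∃ k, U = phasedWord k U.word :=
  ⟨_, (exists_eq_phasedWord U).choose_spec.choose_spec⟩

@[simp] theorem word_phasedWord (k : ℕ) (w : ι → Color) : (phasedWord k w).word = w := by
  obtain ⟨k', h⟩ := exists_eq_phasedWord_word (phasedWord k w)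
  exact (phasedWord_injective_right h).symm

@[simp] theorem PauliGroup.word_one : (1 : PauliGroup ι).word = 0 := by
  rw [← phasedWord_zero_zero, word_phasedWord]

@[simp] theorem PauliGroup.word_mul (U U' : PauliGroup ι) : (U * U').word = U.word + U'.word := by
  obtain ⟨k, h⟩ := exists_eq_phasedWord_word U
  obtain ⟨k', h'⟩ := exists_eq_phasedWord_word U'
  rw [h, h', phasedWord_mul]
  simp

theorem PauliGroup.mat_mul_comm (U U' : PauliGroup ι) :
    (U * U').mat = (-1 : ℂ) ^ (wordForm ι U.word U'.word).val • (U' * U).mat := by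
  obtain ⟨k, h⟩ := exists_eq_phasedWord_word U
  obtain ⟨k', h'⟩ := exists_eq_phasedWord_word U'
  rw [h, h']
  simp only [PauliGroup.mat_mul, mat_phasedWord, word_phasedWord, smul_mul_smul_comm]
  rw [wordMatrix_mul_comm, smul_comm, mul_comm]

theorem PauliGroup.commute_iff (U U' : PauliGroup ι) :
    U * U' = U' * U ↔ wordForm ι U.word U'.word = 0 := by
  have hne : (U' * U).mat ≠ 0 := Units.ne_zero _
  constructor
  · intro h
    refine neg_one_pow_val_injective (smul_left_injective ℂ hne ?_)
    have := PauliGroup.mat_mul_comm U U'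
    rw [h] at this
    simpa using this.symm
  · intro h
    refine PauliGroup.mat_injective ?_
    rw [PauliGroup.mat_mul_comm, h]
    simp

end Word

/-! ## Self-orthogonal spaces of Pauli words -/

theorem symp_comm (c d : Color) : symp c d = symp d c := by
  simp only [symp]; ring

section SelfOrthogonal

variable {ι : Type} [Fintype ι]

theorem mem_orthogonal_word {Λ : Submodule (ZMod 2) (ι → Color)} {w : ι → Color} :
    w ∈ (wordForm ι).orthogonal Λ ↔ ∀ u ∈ Λ, wordForm ι u w = 0 :=
  LinearMap.BilinForm.mem_orthogonal_iff

variable [DecidableEq ι]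

theorem mem_sup_of_mem_orthogonal_inf {Λ K : Submodule (ZMod 2) (ι → Color)}
    (hΛ : (wordForm ι).orthogonal Λ = Λ) {x : ι → Color}
    (hx : x ∈ (wordForm ι).orthogonal (Λ ⊓ (wordForm ι).orthogonal K)) : x ∈ Λ ⊔ K := by
  rw [← LinearMap.BilinForm.orthogonal_orthogonal wordForm_nondegenerate
    wordForm_isSymm.isRefl (Λ ⊔ K)]
  refine LinearMap.BilinForm.orthogonal_le (le_inf ?_ ?_) hx
  · exact (LinearMap.BilinForm.orthogonal_le le_sup_left).trans hΛ.le
  · exact LinearMap.BilinForm.orthogonal_le le_sup_right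

theorem card_of_orthogonal_eq_self {Λ : Submodule (ZMod 2) (ι → Color)}
    (hΛ : (wordForm ι).orthogonal Λ = Λ) : Nat.card Λ = 2 ^ Fintype.card ι := by
  have h := LinearMap.BilinForm.finrank_orthogonal (wordForm_nondegenerate (ι := ι)) Λ
  have h2 : Module.finrank (ZMod 2) (ι → Color) = Fintype.card ι * 2 := by
    rw [Module.finrank_pi_fintype]
    simp
  have h3 := Submodule.finrank_le Λ
  rw [hΛ, h2] at h
  rw [h2] at h3
  rw [Module.natCard_eq_pow_finrank (K := ZMod 2), Nat.card_zmod]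
  congr 1
  omega

end SelfOrthogonal

/-! ## Valid highlights around an elementary tensor -/

theorem SpiderValid.isotropic {k : ℕ} {c c' : Color} (hc : symp c c' = 1)
    {h h' : Fin k → Color} {σ σ' : Color} (H : Tensor.SpiderValid c c' h σ)
    (H' : Tensor.SpiderValid c c' h' σ') : wordForm (Fin k) h h' = 0 := by
  obtain ⟨b, e, h1, h2, -⟩ := H
  obtain ⟨b', e', h1', h2', -⟩ := H'
  have key : ∀ x y : ZMod 2, symp (b • c' + x • c) (b' • c' + y • c) = x * b' + b * y := by
    intro x y
    have h2 : symp c c' = c.1 * c'.2 + c.2 * c'.1 := rfl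
    have h3 : (2 : ZMod 2) = 0 := rfl
    simp only [symp, Prod.fst_add, Prod.snd_add, Prod.smul_fst, Prod.smul_snd, smul_eq_mul]
    linear_combination (x * b' + b * y) * (hc - h2)
      + (b * b' * c'.1 * c'.2 + x * y * c.1 * c.2) * h3
  rw [wordForm_apply]
  simp only [h2, h2', key]
  rw [Finset.sum_add_distrib, ← Finset.sum_mul, ← Finset.mul_sum, h1, h1']
  simp

theorem SpiderValid.of_orthogonal {k : ℕ} {c c' : Color} (hc : symp c c' = 1)
    {h : Fin k → Color}
    (H : ∀ h' σ', Tensor.SpiderValid c c' h' σ' → wordForm (Fin k) h h' = 0) :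
    ∃ σ, Tensor.SpiderValid c c' h σ := by
  have hexp : ∀ c c' x : Color, symp c c' = 1 → x = symp x c • c' + symp x c' • c := by decide
  have hsmul : ∀ (x d : Color) (a : ZMod 2), symp x (a • d) = a * symp x d := by decide
  have hconst : ∀ i j, symp (h i) c = symp (h j) c := by
    intro i j
    have := H (fun l => (Pi.single i 1 + Pi.single j 1 : Fin k → ZMod 2) l • c) 0
      ⟨0, Pi.single i 1 + Pi.single j 1, by
        simp [Finset.sum_add_distrib, zmod_add_self], by simp, by simp⟩
    rw [wordForm_apply] at this
    simp only [hsmul, Pi.add_apply, add_mul, Finset.sum_add_distrib, Pi.single_apply, ite_mul,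
      one_mul, zero_mul, Finset.sum_ite_eq', Finset.mem_univ, if_true] at this
    exact CharTwo.add_eq_zero.1 this
  have hall : ∑ i, symp (h i) c' = 0 :=
    H (fun _ => c') c' ⟨1, 0, by simp, by simp, by simp⟩
  obtain ⟨b, hb⟩ : ∃ b, ∀ i, symp (h i) c = b := by
    rcases k with _ | k
    · exact ⟨0, fun i => i.elim0⟩
    · exact ⟨_, fun i => hconst i 0⟩
  refine ⟨b • c', b, fun i => symp (h i) c', hall, fun i => ?_, rfl⟩
  rw [← hb i]
  exact hexp _ _ _ hc

theorem BasisValid.isotropic {g : Color → Color} (hg : ∀ c d, symp (g c) (g d) = symp c d)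
    {h h' : Fin 2 → Color} {σ σ' : Color} (H : Tensor.BasisValid g h σ)
    (H' : Tensor.BasisValid g h' σ') : wordForm (Fin 2) h h' = 0 := by
  rw [wordForm_apply, Fin.sum_univ_two, H.2, H'.2, hg, zmod_add_self]

theorem BasisValid.of_orthogonal {g : Color → Color} (hg : ∀ c d, symp (g c) (g d) = symp c d)
    (hs : Function.Surjective g) {h : Fin 2 → Color}
    (H : ∀ h' σ', Tensor.BasisValid g h' σ' → wordForm (Fin 2) h h' = 0) :
    ∃ σ, Tensor.BasisValid g h σ := by
  have key : ∀ c d : Color, (∀ e, symp c e = symp d e) → c = d := by decide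
  refine ⟨0, rfl, key _ _ fun e => ?_⟩
  obtain ⟨d, rfl⟩ := hs e
  have := H ![d, g d] 0 ⟨rfl, rfl⟩
  rw [wordForm_apply, Fin.sum_univ_two] at this
  rw [hg]
  exact (CharTwo.add_eq_zero.1 this).symm

namespace Tensor

theorem Valid.isotropic (t : Tensor) {h h' : Fin t.arity → Color} {σ σ' : Color}
    (H : t.Valid h σ) (H' : t.Valid h' σ') : wordForm (Fin t.arity) h h' = 0 := by
  cases t with
  | blue k s => exact SpiderValid.isotropic (by decide) H H'
  | red k s => exact SpiderValid.isotropic (by decide) H H'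
  | green k s f => exact SpiderValid.isotropic (by decide) H H'
  | basisH => exact BasisValid.isotropic (g := fun c => (c.2, c.1)) (by decide) H H'
  | basisS => exact BasisValid.isotropic (g := fun c => (c.1, c.1 + c.2)) (by decide) H H'
  | basisHS => exact BasisValid.isotropic (g := fun c => (c.2, c.1 + c.2)) (by decide) H H'

theorem Valid.of_orthogonal (t : Tensor) {h : Fin t.arity → Color}
    (H : ∀ h' σ', t.Valid h' σ' → wordForm (Fin t.arity) h h' = 0) : ∃ σ, t.Valid h σ := by
  cases t with
  | blue k s => exact SpiderValid.of_orthogonal (by decide) H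
  | red k s => exact SpiderValid.of_orthogonal (by decide) H
  | green k s f => exact SpiderValid.of_orthogonal (by decide) H
  | basisH => exact BasisValid.of_orthogonal (g := fun c => (c.2, c.1)) (by decide) (by decide) H
  | basisS => exact BasisValid.of_orthogonal (g := fun c => (c.1, c.1 + c.2)) (by decide) (by decide) H
  | basisHS => exact BasisValid.of_orthogonal (g := fun c => (c.2, c.1 + c.2)) (by decide) (by decide) H

end Tensor

/-! ## The open words of a network -/

@[to_additive sum_comp_eq_sum_card_nsmul]
theorem prod_comp_eq_prod_pow_card {κ ε M : Type*} [Fintype κ] [Fintype ε] [DecidableEq ε]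
    [CommMonoid M] (g : κ → ε) (F : ε → M) :
    ∏ i, F (g i) = ∏ e, F e ^ Fintype.card {i // g i = e} := by
  rw [← Finset.prod_fiberwise Finset.univ g]
  refine Finset.prod_congr rfl fun e _ => ?_
  rw [Fintype.card_subtype, Finset.prod_congr rfl (g := fun _ => F e), Finset.prod_const]
  intro i hi
  rw [(Finset.mem_filter.1 hi).2]

namespace Network

variable {n m : ℕ} (T : Network n m)

/-- The legs of the elementary tensors of a network. -/
abbrev Leg : Type := (v : T.V) × Fin (T.tensor v).arity

/-- The ends of the edges of a network: legs of tensors and open legs. -/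
abbrev End : Type := T.Leg ⊕ (Fin n ⊕ Fin m)

/-- The edge to which an end belongs. -/
def endEdge : T.End → T.E := Sum.elim (fun l => T.legEdge l.1 l.2) T.openEdge

theorem card_endEdge_fiber (e : T.E) : Fintype.card {x // T.endEdge x = e} = 2 := by
  rw [← T.two_ends e, ← Fintype.card_sum]
  exact Fintype.card_congr (Equiv.subtypeSum (p := fun x => T.endEdge x = e))

/-- The labelings of the ends by highlights of the edges. -/
def edgeWords : Submodule (ZMod 2) (T.End → Color) :=
  LinearMap.range (LinearMap.funLeft (ZMod 2) Color T.endEdge)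

theorem mem_edgeWords {g : T.End → Color} :
    g ∈ T.edgeWords ↔ ∃ f : T.E → Color, ∀ x, g x = f (T.endEdge x) := by
  constructor
  · rintro ⟨f, rfl⟩
    exact ⟨f, fun _ => rfl⟩
  · rintro ⟨f, h⟩
    exact ⟨f, funext fun x => (h x).symm⟩

theorem orthogonal_edgeWords : (wordForm T.End).orthogonal T.edgeWords = T.edgeWords := by
  classical
  ext g
  rw [mem_orthogonal_word, mem_edgeWords]
  constructor
  · intro H
    have key : ∀ c d : Color, (∀ e, symp c e + symp d e = 0) → c = d := by decide
    have hconst : ∀ x y, T.endEdge x = T.endEdge y → g x = g y := by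
      intro x y hxy
      by_cases hne : x = y
      · rw [hne]
      refine key _ _ fun c => ?_
      have h1 := H (fun z => (Pi.single (T.endEdge y) c : T.E → Color) (T.endEdge z))
        (T.mem_edgeWords.2 ⟨_, fun _ => rfl⟩)
      have hpair : (Finset.univ.filter fun z => T.endEdge z = T.endEdge y) = {x, y} := by
        symm
        refine Finset.eq_of_subset_of_card_le ?_ ?_
        · intro z hz
          rcases Finset.mem_insert.1 hz with rfl | hz
          · simpa using hxy
          · simp [Finset.mem_singleton.1 hz]
        · rw [Finset.card_pair hne, ← Fintype.card_subtype, T.card_endEdge_fiber]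
      rw [wordForm_apply, ← Finset.sum_subset (Finset.subset_univ {x, y}),
        Finset.sum_pair hne] at h1
      · simpa [hxy, symp_comm c] using h1
      · intro z _ hz
        rw [← hpair] at hz
        have hz' : T.endEdge z ≠ T.endEdge y := by simpa using hz
        simp [Pi.single_eq_of_ne hz', symp]
    have hsurj : ∀ e, ∃ x, T.endEdge x = e := by
      intro e
      have : 0 < Fintype.card {x // T.endEdge x = e} := by
        rw [T.card_endEdge_fiber]; norm_num
      obtain ⟨x⟩ := Fintype.card_pos_iff.1 this
      exact ⟨x.1, x.2⟩
    choose s hs using hsurj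
    exact ⟨fun e => g (s e), fun x => hconst _ _ (hs _).symm⟩
  · rintro ⟨f, hf⟩ u hu
    obtain ⟨f', hf'⟩ := T.mem_edgeWords.1 hu
    rw [wordForm_apply]
    simp only [hf, hf']
    rw [sum_comp_eq_sum_card_nsmul T.endEdge fun e => symp (f' e) (f e)]
    refine Finset.sum_eq_zero fun e _ => ?_
    rw [T.card_endEdge_fiber, two_nsmul, zmod_add_self]

/-- The labelings of the ends that are valid around every tensor and trivial on the open legs. -/
def tensorWords : Submodule (ZMod 2) (T.End → Color) where
  carrier := {g | (∀ v, ∃ σ, (T.tensor v).Valid (fun i => g (Sum.inl ⟨v, i⟩)) σ) ∧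
    ∀ i, g (Sum.inr i) = 0}
  zero_mem' := ⟨fun _ => ⟨0, Tensor.Valid.zero _⟩, fun _ => rfl⟩
  add_mem' {g g'} hg hg' := by
    refine ⟨fun v => ?_, fun i => ?_⟩
    · obtain ⟨σ, hσ⟩ := hg.1 v
      obtain ⟨σ', hσ'⟩ := hg'.1 v
      exact ⟨_, Tensor.Valid.add _ hσ hσ'⟩
    · rw [Pi.add_apply, hg.2, hg'.2, add_zero]
  smul_mem' a g hg := by
    rcases zmod_two_cases a with rfl | rfl
    · simp only [zero_smul]
      exact ⟨fun _ => ⟨0, Tensor.Valid.zero _⟩, fun _ => rfl⟩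
    · simpa only [one_smul] using hg

theorem valid_of_mem_orthogonal_tensorWords {g : T.End → Color}
    (hg : g ∈ (wordForm T.End).orthogonal T.tensorWords) (v : T.V) :
    ∃ σ, (T.tensor v).Valid (fun i => g (Sum.inl ⟨v, i⟩)) σ := by
  classical
  refine Tensor.Valid.of_orthogonal _ fun h σ hv => ?_
  let h' : ∀ v, Fin (T.tensor v).arity → Color := Pi.single v h
  have h1 := mem_orthogonal_word.1 hg (Sum.elim (fun l => h' l.1 l.2) 0) (by
    refine ⟨fun v' => ?_, fun _ => rfl⟩
    by_cases hvv : v' = v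
    · subst hvv
      exact ⟨σ, by simpa [h'] using hv⟩
    · have h0 : (fun i => h' v' i) = 0 := by simp only [h', Pi.single_eq_of_ne hvv]
      exact ⟨0, by simpa only [Sum.elim_inl, h0] using Tensor.Valid.zero (T.tensor v')⟩)
  rw [wordForm_apply, Fintype.sum_sum_type, Fintype.sum_sigma, Finset.sum_eq_single v] at h1
  · simpa [h', symp, wordForm_apply, mul_comm, add_comm] using h1
  · intro v' _ hv'
    simp [h', Pi.single_eq_of_ne hv', symp]
  · simp

/-- The restriction of flows to the open legs, as a homomorphism. -/
def openHom : T.flows →+ (Fin n ⊕ Fin m → Color) where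
  toFun := T.openColors
  map_zero' := rfl
  map_add' _ _ := rfl

@[simp] theorem openHom_apply (f : T.flows) : T.openHom f = T.openColors f := rfl

theorem detectorFlows_eq_ker : T.detectorFlows = T.openHom.ker := by
  ext f
  rw [AddMonoidHom.mem_ker]
  exact (funext_iff (f := T.openColors f) (g := 0)).symm

/-- The highlights of the open legs that extend to Pauli flows. -/
def openWords : Submodule (ZMod 2) (Fin n ⊕ Fin m → Color) :=
  AddSubgroup.toZModSubmodule 2 T.openHom.range

theorem mem_openWords {u : Fin n ⊕ Fin m → Color} :
    u ∈ T.openWords ↔ ∃ f, T.openColors f = u := Iff.rfl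

theorem wordForm_openColors (f f' : T.flows) :
    wordForm _ (T.openColors f) (T.openColors f') = 0 := by
  have h : wordForm T.End (fun x => f.1.1 (T.endEdge x)) (fun x => f'.1.1 (T.endEdge x)) = 0 := by
    have h1 := T.mem_edgeWords.2 ⟨f'.1.1, fun _ => rfl⟩
    rw [← orthogonal_edgeWords] at h1
    exact mem_orthogonal_word.1 h1 _ (T.mem_edgeWords.2 ⟨f.1.1, fun _ => rfl⟩)
  rw [wordForm_apply, Fintype.sum_sum_type, Fintype.sum_sigma, Finset.sum_eq_zero, zero_add] at h
  · exact h
  · intro v _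
    exact Tensor.Valid.isotropic _ (f.2 v) (f'.2 v)

theorem orthogonal_openWords : (wordForm _).orthogonal T.openWords = T.openWords := by
  classical
  ext u
  rw [mem_orthogonal_word]
  constructor
  · intro H
    have h1 : (Sum.elim 0 u : T.End → Color) ∈ T.edgeWords ⊔ T.tensorWords := by
      refine mem_sup_of_mem_orthogonal_inf T.orthogonal_edgeWords (mem_orthogonal_word.2 ?_)
      rintro g ⟨hg, hg'⟩
      obtain ⟨f, hf⟩ := T.mem_edgeWords.1 hg
      choose σ hσ using T.valid_of_mem_orthogonal_tensorWords hg'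
      simp only [hf] at hσ
      have h2 := H _ (T.mem_openWords.2 ⟨⟨(f, σ), hσ⟩, rfl⟩)
      rw [wordForm_apply, Fintype.sum_sum_type, Finset.sum_eq_zero, zero_add]
      · simp only [hf]
        exact h2
      · intro l _
        simp [symp]
    obtain ⟨w, hw, k, hk, hwk⟩ := Submodule.mem_sup.1 h1
    obtain ⟨f, hf⟩ := T.mem_edgeWords.1 hw
    have hleg : ∀ l, k (Sum.inl l) = f (T.legEdge l.1 l.2) := by
      intro l
      have h2 : w (Sum.inl l) + k (Sum.inl l) = 0 := congrFun hwk (Sum.inl l)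
      rw [← add_right_inj (w (Sum.inl l)), h2, hf]
      exact (ZModModule.add_self (f (T.endEdge (Sum.inl l)))).symm
    have hopen : ∀ i, f (T.openEdge i) = u i := by
      intro i
      have h2 : w (Sum.inr i) + k (Sum.inr i) = u i := congrFun hwk (Sum.inr i)
      rw [hk.2, add_zero, hf] at h2
      exact h2
    choose σ hσ using hk.1
    simp only [hleg] at hσ
    exact T.mem_openWords.2 ⟨⟨(f, σ), hσ⟩, funext hopen⟩
  · intro hu v hv
    obtain ⟨f, rfl⟩ := T.mem_openWords.1 hu
    obtain ⟨f', rfl⟩ := T.mem_openWords.1 hv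
    exact T.wordForm_openColors f' f

theorem card_openWords : Nat.card T.openWords = 2 ^ (n + m) := by
  rw [card_of_orthogonal_eq_self T.orthogonal_openWords]
  simp

end Network

/-! ## Eigenvectors of Pauli words -/

section Eigen

variable {ι : Type} [Fintype ι] [DecidableEq ι]

/-- The highlight `h` is a projective symmetry of the vector `t`. -/
def IsEigenWord (t : (ι → ZMod 2) → ℂ) (h : ι → Color) : Prop :=
  ∃ ζ : ℂ, wordMatrix h *ᵥ t = ζ • t

theorem IsEigenWord.add {t : (ι → ZMod 2) → ℂ} {h h' : ι → Color} (H : IsEigenWord t h)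
    (H' : IsEigenWord t h') : IsEigenWord t (h + h') := by
  obtain ⟨ζ, hζ⟩ := H
  obtain ⟨ζ', hζ'⟩ := H'
  have h1 : wordMatrix (h + h')
      = (-Complex.I) ^ (∑ i, mulPhase (h i) (h' i)) • (wordMatrix h * wordMatrix h') := by
    rw [wordMatrix_mul, smul_smul, ← mul_pow]
    simp
  refine ⟨(-Complex.I) ^ (∑ i, mulPhase (h i) (h' i)) * (ζ' * ζ), ?_⟩
  rw [h1, Matrix.smul_mulVec, ← Matrix.mulVec_mulVec, hζ', Matrix.mulVec_smul, hζ, smul_smul,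
    smul_smul, mul_assoc]

theorem IsEigenWord.eq_or_eq_neg {t : (ι → ZMod 2) → ℂ} {h : ι → Color} (H : IsEigenWord t h) :
    wordMatrix h *ᵥ t = t ∨ wordMatrix h *ᵥ t = -t := by
  obtain ⟨ζ, hζ⟩ := H
  have h1 : wordMatrix h *ᵥ (wordMatrix h *ᵥ t) = t := by
    rw [Matrix.mulVec_mulVec, wordMatrix_mul_self, Matrix.one_mulVec]
  rw [hζ, Matrix.mulVec_smul, hζ, smul_smul] at h1
  by_cases ht : t = 0
  · left
    rw [ht, Matrix.mulVec_zero]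
  · have h2 : ζ * ζ = 1 := smul_left_injective ℂ ht (h1.trans (one_smul ℂ t).symm)
    rcases mul_self_eq_one_iff.1 h2 with rfl | rfl
    · left
      rw [hζ, one_smul]
    · right
      rw [hζ, neg_one_smul]

theorem isEigenWord_of_rowEntry {t : (ι → ZMod 2) → ℂ} {h : ι → Color} (ζ : ℂ)
    (H : ∀ z, (∏ i, rowEntry (h i) (z i)) * t (fun i => z i + (h i).1) = ζ * t z) :
    IsEigenWord t h :=
  ⟨ζ, funext fun z => by rw [wordMatrix_mulVec, H, Pi.smul_apply, smul_eq_mul]⟩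

end Eigen

theorem fst_blue : blue.1 = 0 := rfl

theorem fst_red : red.1 = 1 := rfl

theorem rowEntry_blue (z : ZMod 2) : rowEntry blue z = (-1) ^ z.val := by
  simp [rowEntry, pauliMatrix, blue, ZMod.val_one]

theorem rowEntry_red (z : ZMod 2) : rowEntry red z = 1 := by
  simp [rowEntry, pauliMatrix, red, add_assoc, one_add_one]

theorem rowEntry_zero (z : ZMod 2) : rowEntry 0 z = 1 := by
  simp [rowEntry, pauliMatrix]

theorem rowEntry_green (z : ZMod 2) : rowEntry green z = -Complex.I * (-1) ^ z.val := by
  rcases zmod_two_cases z with rfl | rfl <;>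
    simp [rowEntry, pauliMatrix, green, one_add_one, ZMod.val_one]

theorem rowEntry_smul_blue (e z : ZMod 2) : rowEntry (e • blue) z = (-1) ^ (e * z).val := by
  rcases zmod_two_cases e with rfl | rfl
  · simp [rowEntry_zero]
  · simp [rowEntry_blue]

namespace Tensor

theorem isEigenWord_of_spiderValid {k : ℕ} {c c' : Color} {t : (Fin k → ZMod 2) → ℂ}
    (hc : ∀ e : Fin k → ZMod 2, ∑ i, e i = 0 → IsEigenWord t fun i => e i • c)
    (hc' : IsEigenWord t fun _ => c') {h : Fin k → Color} {σ : Color}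
    (H : SpiderValid c c' h σ) : IsEigenWord t h := by
  obtain ⟨b, e, he, hh, -⟩ := H
  have h1 : h = (fun _ => b • c') + fun i => e i • c := funext hh
  rw [h1]
  refine IsEigenWord.add ?_ (hc e he)
  rcases zmod_two_cases b with rfl | rfl
  · refine ⟨1, ?_⟩
    have : (fun _ => (0 : ZMod 2) • c' : Fin k → Color) = 0 := by
      funext i; exact zero_smul _ _
    rw [this, wordMatrix_zero, Matrix.one_mulVec, one_smul]
  · simpa only [one_smul] using hc'

theorem isEigenWord_blueSpider {k : ℕ} (s : ZMod 2) {h : Fin k → Color} {σ : Color}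
    (H : SpiderValid RGB.blue RGB.red h σ) : IsEigenWord (entry (blue k s)) h := by
  refine isEigenWord_of_spiderValid (fun e he => ?_) ?_ H
  · refine isEigenWord_of_rowEntry 1 fun z => ?_
    simp only [entry, Finset.mul_sum, rowEntry_smul_blue, Prod.smul_fst, fst_blue, smul_zero,
      add_zero, one_mul]
    refine Finset.sum_congr rfl fun a _ => ?_
    split_ifs with hz
    · rw [← neg_one_pow_val_sum]
      simp only [hz, ← Finset.sum_mul, he]
      simp
    · simp
  · refine isEigenWord_of_rowEntry ((-1) ^ s.val) fun z => ?_
    have h1 : ∀ a : ZMod 2, (∀ i, z i + 1 = a) ↔ ∀ i, z i = a + 1 := fun a =>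
      forall_congr' fun i => by
        rw [← CharTwo.sub_eq_add, sub_eq_iff_eq_add]
    simp only [entry, rowEntry_red, fst_red, Finset.prod_const_one, one_mul, h1]
    rw [← Equiv.sum_comp (Equiv.addRight (1 : ZMod 2)), Finset.mul_sum]
    refine Finset.sum_congr rfl fun a _ => ?_
    simp only [Equiv.coe_addRight, add_assoc, one_add_one, add_zero, mul_ite, mul_zero]
    split_ifs
    · rcases zmod_two_cases a with rfl | rfl <;> rcases zmod_two_cases s with rfl | rfl <;>
        simp [ZMod.val_one, one_add_one]
    · rfl

theorem isEigenWord_paritySpider {k : ℕ} (s : ZMod 2) {c : Color} (hc : c.1 = 1)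
    (g : Fin k → ZMod 2 → ℂ) (ζ : Fin k → ℂ)
    (hg : ∀ i z, rowEntry c z * g i (z + 1) = ζ i * g i z) {h : Fin k → Color} {σ : Color}
    (H : SpiderValid c RGB.blue h σ) :
    IsEigenWord (fun x => if ∑ i, x i = s then ∏ i, g i (x i) else 0) h := by
  refine isEigenWord_of_spiderValid (fun e he => ?_) ?_ H
  · refine isEigenWord_of_rowEntry (∏ i, if e i = 0 then 1 else ζ i) fun z => ?_
    simp only [Prod.smul_fst, hc, smul_eq_mul, mul_one, Finset.sum_add_distrib, he, add_zero]
    split_ifs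
    · rw [← Finset.prod_mul_distrib, ← Finset.prod_mul_distrib]
      refine Finset.prod_congr rfl fun i _ => ?_
      rcases zmod_two_cases (e i) with hi | hi
      · simp [hi, rowEntry_zero]
      · simp [hi, hg]
    · simp
  · refine isEigenWord_of_rowEntry ((-1) ^ s.val) fun z => ?_
    simp only [rowEntry_blue, ← neg_one_pow_val_sum, fst_blue, add_zero]
    split_ifs with hz
    · rw [hz]
    · simp

theorem isEigenWord_of_basisValid {g : Color → Color} (hg : ∀ c d, g (c + d) = g c + g d)
    {t : (Fin 2 → ZMod 2) → ℂ} (h1 : IsEigenWord t ![RGB.red, g RGB.red])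
    (h2 : IsEigenWord t ![RGB.blue, g RGB.blue]) {h : Fin 2 → Color} {σ : Color}
    (H : BasisValid g h σ) : IsEigenWord t h := by
  have hh : h = ![h 0, g (h 0)] := by
    funext i
    fin_cases i
    · rfl
    · exact H.2
  have h0 : g 0 = 0 := by simpa using hg 0 0
  have key : ∀ c : Color, c = 0 ∨ c = RGB.red ∨ c = RGB.blue ∨ c = RGB.red + RGB.blue := by
    decide
  rw [hh]
  rcases key (h 0) with h' | h' | h' | h' <;> rw [h']
  · refine ⟨1, ?_⟩
    have : (![0, g 0] : Fin 2 → Color) = 0 := by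
      rw [h0]; simp
    rw [this, wordMatrix_zero, Matrix.one_mulVec, one_smul]
  · exact h1
  · exact h2
  · have := h1.add h2
    rwa [show (![RGB.red, g RGB.red] + ![RGB.blue, g RGB.blue] : Fin 2 → Color)
      = ![RGB.red + RGB.blue, g (RGB.red + RGB.blue)] by rw [hg]; simp] at this

theorem isEigenWord_two {t : (Fin 2 → ZMod 2) → ℂ} {c d : Color}
    (H : ∀ a b, rowEntry c a * rowEntry d b * t ![a + c.1, b + d.1] = t ![a, b]) :
    IsEigenWord t ![c, d] := by
  refine isEigenWord_of_rowEntry 1 fun z => ?_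
  have h1 : (fun i => z i + ((![c, d] : Fin 2 → Color) i).1) = ![z 0 + c.1, z 1 + d.1] := by
    funext i; fin_cases i <;> rfl
  have h2 : z = ![z 0, z 1] := by
    funext i; fin_cases i <;> rfl
  rw [h1, Fin.prod_univ_two, one_mul]
  conv_rhs => rw [h2]
  exact H _ _

theorem isEigenWord_basisH {h : Fin 2 → Color} {σ : Color}
    (H : BasisValid (fun c => (c.2, c.1)) h σ) : IsEigenWord hEntry h := by
  refine isEigenWord_of_basisValid (by decide) (isEigenWord_two fun a b => ?_)
    (isEigenWord_two fun a b => ?_) H <;>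
  rcases zmod_two_cases a with rfl | rfl <;> rcases zmod_two_cases b with rfl | rfl <;>
    simp [hEntry, rowEntry, pauliMatrix, RGB.red, RGB.blue, ZMod.val_one, one_add_one]

theorem isEigenWord_basisS {h : Fin 2 → Color} {σ : Color}
    (H : BasisValid (fun c => (c.1, c.1 + c.2)) h σ) : IsEigenWord sEntry h := by
  refine isEigenWord_of_basisValid (by decide) (isEigenWord_two fun a b => ?_)
    (isEigenWord_two fun a b => ?_) H <;>
  rcases zmod_two_cases a with rfl | rfl <;> rcases zmod_two_cases b with rfl | rfl <;>
    simp [sEntry, rowEntry, pauliMatrix, RGB.red, RGB.blue, ZMod.val_one, one_add_one]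

theorem isEigenWord_basisHS {h : Fin 2 → Color} {σ : Color}
    (H : BasisValid (fun c => (c.2, c.1 + c.2)) h σ) : IsEigenWord hsEntry h := by
  have h3 : Complex.I ^ 3 = -Complex.I := Complex.I_pow_three
  refine isEigenWord_of_basisValid (by decide) (isEigenWord_two fun a b => ?_)
    (isEigenWord_two fun a b => ?_) H <;>
  rcases zmod_two_cases a with rfl | rfl <;> rcases zmod_two_cases b with rfl | rfl <;>
    simp [hsEntry, rowEntry, pauliMatrix, RGB.red, RGB.blue, ZMod.val_one, one_add_one, h3,
      mul_comm (Complex.I), mul_assoc]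

theorem Valid.isEigenWord : (t : Tensor) → {h : Fin t.arity → Color} → {σ : Color} →
    t.Valid h σ → IsEigenWord t.entry h
  | blue _ s, _, _, H => isEigenWord_blueSpider s H
  | red k s, _, _, H => by
    have := isEigenWord_paritySpider s (c := RGB.red) rfl (fun _ : Fin k => fun _ => 1)
      (fun _ => 1) (fun i z => by simp [rowEntry_red]) H
    simp only [Finset.prod_const_one] at this
    exact this
  | green k s flip, _, _, H =>
    isEigenWord_paritySpider s (c := RGB.green) rfl
      (fun i z => (if flip i then -Complex.I else Complex.I) ^ z.val)
      (fun i => -Complex.I * (if flip i then -Complex.I else Complex.I)) (fun i z => by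
        rcases zmod_two_cases z with rfl | rfl <;> rcases flip i <;>
          simp [rowEntry_green, ZMod.val_one, one_add_one]) H
  | basisH, _, _, H => isEigenWord_basisH H
  | basisS, _, _, H => isEigenWord_basisS H
  | basisHS, _, _, H => isEigenWord_basisHS H

theorem Valid.wordMatrix_mulVec_entry (t : Tensor) {h : Fin t.arity → Color} {σ : Color}
    (H : t.Valid h σ) :
    wordMatrix h *ᵥ t.entry = (-1 : ℂ) ^ (t.symmetrySign h).val • t.entry := by
  unfold symmetrySign
  split_ifs with h1
  · simpa using h1
  · rcases (H.isEigenWord t).eq_or_eq_neg with h2 | h2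
    · exact absurd h2 h1
    · simpa [ZMod.val_one] using h2

end Tensor

/-! ## Flows act on the contracted network by signs -/

namespace Network

variable {n m : ℕ} (T : Network n m)

theorem prod_open_rowEntry (f : T.E → Color) (x : T.E → ZMod 2) :
    ∏ i, rowEntry (f (T.openEdge i)) (x (T.openEdge i))
      = (-1 : ℂ) ^ (∑ e, if f e = green ∧ T.openEnds e ≠ 1 then (1 : ZMod 2) else 0).val
        * ∏ v, ∏ i, rowEntry (f (T.legEdge v i)) (x (T.legEdge v i)) := by
  have hleg : ∏ v, ∏ i, rowEntry (f (T.legEdge v i)) (x (T.legEdge v i))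
      = ∏ l : T.Leg, rowEntry (f (T.legEdge l.1 l.2)) (x (T.legEdge l.1 l.2)) := by
    rw [Fintype.prod_sigma]
  rw [hleg, prod_comp_eq_prod_pow_card T.openEdge fun e => rowEntry (f e) (x e),
    prod_comp_eq_prod_pow_card (fun l : T.Leg => T.legEdge l.1 l.2)
      fun e => rowEntry (f e) (x e), neg_one_pow_val_sum, ← Finset.prod_mul_distrib]
  refine Finset.prod_congr rfl fun e _ => ?_
  have h2 := T.two_ends e
  have hsq := rowEntry_sq (f e) (x e)
  change _ + T.openEnds e = 2 at h2
  change _ ^ T.openEnds e = _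
  have h3 : T.openEnds e = 0 ∨ T.openEnds e = 1 ∨ T.openEnds e = 2 := by omega
  rcases h3 with h3 | h3 | h3 <;> rw [h3] at h2 ⊢
  · rw [show Fintype.card {l : T.Leg // T.legEdge l.1 l.2 = e} = 2 from h2, hsq]
    by_cases hg : f e = green <;> simp [hg, ZMod.val_one]
  · rw [show Fintype.card {l : T.Leg // T.legEdge l.1 l.2 = e} = 1 from by simpa using h2]
    simp
  · rw [show Fintype.card {l : T.Leg // T.legEdge l.1 l.2 = e} = 0 from by simpa using h2, hsq]
    by_cases hg : f e = green <;> simp [hg, ZMod.val_one]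

theorem wordMatrix_mulVec_eval (f : T.flows) :
    wordMatrix (T.openColors f) *ᵥ T.eval = (-1 : ℂ) ^ (T.sgn false f).val • T.eval := by
  have htensor : ∀ (x : T.E → ZMod 2),
      (∏ v, ∏ i, rowEntry (f.1.1 (T.legEdge v i)) (x (T.legEdge v i)))
        * (∏ v, (T.tensor v).entry fun i => x (T.legEdge v i) + (f.1.1 (T.legEdge v i)).1)
      = (-1 : ℂ) ^ (∑ v, (T.tensor v).symmetrySign fun i => f.1.1 (T.legEdge v i)).val
        * ∏ v, (T.tensor v).entry fun i => x (T.legEdge v i) := by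
    intro x
    rw [neg_one_pow_val_sum, ← Finset.prod_mul_distrib, ← Finset.prod_mul_distrib]
    refine Finset.prod_congr rfl fun v _ => ?_
    have h1 := congrFun (Tensor.Valid.wordMatrix_mulVec_entry (T.tensor v) (f.2 v))
      fun i => x (T.legEdge v i)
    rwa [wordMatrix_mulVec, Pi.smul_apply, smul_eq_mul] at h1
  funext y
  rw [wordMatrix_mulVec, Pi.smul_apply, smul_eq_mul, eval, eval,
    ← Equiv.sum_comp (Equiv.addRight fun e => (f.1.1 e).1), Finset.mul_sum, Finset.mul_sum]
  refine Finset.sum_congr rfl fun x _ => ?_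
  simp only [Equiv.coe_addRight, Pi.add_apply, openColors, add_left_inj]
  split_ifs with hx
  · simp only [← hx]
    rw [prod_open_rowEntry, mul_assoc, htensor, ← mul_assoc, ← neg_one_pow_val_add, sgn]
    simp [add_comm]
  · simp

/-- The signed Pauli word of a flow. -/
noncomputable def signedPauli (o : Bool) (f : T.flows) : PauliGroup (Fin n ⊕ Fin m) :=
  phasedWord (2 * (T.sgn o f).val) (T.openColors f)

theorem mat_signedPauli (o : Bool) (f : T.flows) :
    (T.signedPauli o f).mat = (-1 : ℂ) ^ (T.sgn o f).val • (T.unsignedPauli f).mat := by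
  rw [signedPauli, mat_phasedWord, ← neg_one_pow_eq_I_pow, unsignedPauli, mat_phasedWord, pow_zero,
    one_smul]

@[simp] theorem word_signedPauli (o : Bool) (f : T.flows) :
    (T.signedPauli o f).word = T.openColors f := word_phasedWord _ _

theorem oriented_signedPauli_mulVec (o : Bool) (f : T.flows) :
    oriented o (T.signedPauli o f).mat *ᵥ T.eval = T.eval := by
  have hsq : ∀ s : ZMod 2, (-1 : ℂ) ^ s.val * (-1) ^ s.val = 1 := fun s => by
    rw [← neg_one_pow_val_add, zmod_add_self, ZMod.val_zero, pow_zero]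
  rw [signedPauli, mat_phasedWord, ← neg_one_pow_eq_I_pow]
  cases o with
  | false =>
    change ((-1 : ℂ) ^ (T.sgn false f).val • wordMatrix (T.openColors f)) *ᵥ T.eval = T.eval
    rw [Matrix.smul_mulVec, wordMatrix_mulVec_eval, smul_smul, hsq, one_smul]
  | true =>
    have h1 : T.sgn true f
        = T.sgn false f + ∑ i, if T.openColors f i = green then (1 : ZMod 2) else 0 := by
      simp [sgn]
    change ((-1 : ℂ) ^ (T.sgn true f).val • wordMatrix (T.openColors f))ᵀ *ᵥ T.eval = T.eval
    rw [Matrix.transpose_smul, wordMatrix_transpose, smul_smul, h1, neg_one_pow_val_add, mul_assoc,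
      hsq, mul_one, Matrix.smul_mulVec, wordMatrix_mulVec_eval, smul_smul, hsq, one_smul]

end Network

/-! ## Subgroups of the Pauli group determined by their words -/

section Lagrangian

variable {ι : Type} [Fintype ι] [DecidableEq ι]

@[simp] theorem PauliGroup.word_inv (U : PauliGroup ι) : U⁻¹.word = -U.word := by
  rw [eq_neg_iff_add_eq_zero, ← PauliGroup.word_mul, inv_mul_cancel, PauliGroup.word_one]

/-- The Pauli operators with a word in `C`. -/
def wordSubgroup (C : Submodule (ZMod 2) (ι → Color)) : Subgroup (PauliGroup ι) where
  carrier := {U | U.word ∈ C}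
  one_mem' := by simp [C.zero_mem]
  mul_mem' {U U'} h h' := by
    simp only [Set.mem_ofPred_eq, PauliGroup.word_mul] at *
    exact C.add_mem h h'
  inv_mem' {U} h := by
    simp only [Set.mem_ofPred_eq, PauliGroup.word_inv] at *
    exact C.neg_mem h

/-- `S` consists of one signed Pauli operator for each word of the self-orthogonal space `Λ`. -/
structure IsLagrangian (S : Subgroup (PauliGroup ι)) (Λ : Submodule (ZMod 2) (ι → Color)) :
    Prop where
  orthogonal_eq : (wordForm ι).orthogonal Λ = Λ
  mem_iff : ∀ w, w ∈ Λ ↔ ∃ U ∈ S, U.word = w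
  eq_of_word_eq : ∀ {U U'}, U ∈ S → U' ∈ S → U.word = U'.word → U = U'

namespace IsLagrangian

variable {S : Subgroup (PauliGroup ι)} {Λ : Submodule (ZMod 2) (ι → Color)}

theorem word_mem (hS : IsLagrangian S Λ) {U : PauliGroup ι} (hU : U ∈ S) : U.word ∈ Λ :=
  (hS.mem_iff _).2 ⟨U, hU, rfl⟩

theorem mul_comm (hS : IsLagrangian S Λ) {U U' : PauliGroup ι} (hU : U ∈ S) (hU' : U' ∈ S) :
    U * U' = U' * U :=
  hS.eq_of_word_eq (S.mul_mem hU hU') (S.mul_mem hU' hU) (by simp [add_comm])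

theorem eq_one_of_word_eq_zero (hS : IsLagrangian S Λ) {U : PauliGroup ι} (hU : U ∈ S)
    (h : U.word = 0) : U = 1 :=
  hS.eq_of_word_eq hU S.one_mem (by rw [h, PauliGroup.word_one])

theorem exists_word_sub_mem (hS : IsLagrangian S Λ) (K : Submodule (ZMod 2) (ι → Color))
    {x : ι → Color}
    (h : ∀ U ∈ S, U.word ∈ (wordForm ι).orthogonal K → wordForm ι U.word x = 0) :
    ∃ U ∈ S, U.word - x ∈ K := by
  have h1 : x ∈ Λ ⊔ K := by
    refine mem_sup_of_mem_orthogonal_inf hS.orthogonal_eq (mem_orthogonal_word.2 ?_)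
    rintro u ⟨hu, hu'⟩
    obtain ⟨U, hU, rfl⟩ := (hS.mem_iff u).1 hu
    exact h U hU hu'
  obtain ⟨u, hu, k, hk, rfl⟩ := Submodule.mem_sup.1 h1
  obtain ⟨U, hU, rfl⟩ := (hS.mem_iff u).1 hu
  exact ⟨U, hU, by simpa using hk⟩

end IsLagrangian

/-! ## The Pauli operators that fix a vector -/

theorem oriented_one {κ : Type} [DecidableEq κ] (o : Bool) :
    oriented o (1 : Matrix κ κ ℂ) = 1 := by
  cases o
  · rfl
  · exact Matrix.transpose_one

/-- The Pauli operators that fix `v` when they are read in the orientation `o`. -/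
def fixingSubgroup (o : Bool) (v : (ι → ZMod 2) → ℂ) : Subgroup (PauliGroup ι) where
  carrier := {U | oriented o U.mat *ᵥ v = v}
  one_mem' := by simp [oriented_one]
  mul_mem' {U U'} h h' := by
    cases o with
    | false =>
      change U.mat *ᵥ v = v at h
      change U'.mat *ᵥ v = v at h'
      change (U * U').mat *ᵥ v = v
      rw [PauliGroup.mat_mul, ← Matrix.mulVec_mulVec, h', h]
    | true =>
      change U.matᵀ *ᵥ v = v at h
      change U'.matᵀ *ᵥ v = v at h'
      change (U * U').matᵀ *ᵥ v = v
      rw [PauliGroup.mat_mul, Matrix.transpose_mul, ← Matrix.mulVec_mulVec, h, h']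
  inv_mem' {U} h := by
    cases o with
    | false =>
      change U.mat *ᵥ v = v at h
      change U⁻¹.mat *ᵥ v = v
      conv_lhs => rw [← h]
      rw [Matrix.mulVec_mulVec, ← PauliGroup.mat_mul, inv_mul_cancel, PauliGroup.mat_one,
        Matrix.one_mulVec]
    | true =>
      change U.matᵀ *ᵥ v = v at h
      change U⁻¹.matᵀ *ᵥ v = v
      conv_lhs => rw [← h]
      rw [Matrix.mulVec_mulVec, ← Matrix.transpose_mul, ← PauliGroup.mat_mul, mul_inv_cancel,
        PauliGroup.mat_one, Matrix.transpose_one, Matrix.one_mulVec]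

theorem mem_fixingSubgroup {o : Bool} {v : (ι → ZMod 2) → ℂ} {U : PauliGroup ι} :
    U ∈ fixingSubgroup o v ↔ oriented o U.mat *ᵥ v = v := Iff.rfl

theorem eq_one_of_mat_eq_smul_one {o : Bool} {v : (ι → ZMod 2) → ℂ} (hv : v ≠ 0)
    {U : PauliGroup ι} (hU : U ∈ fixingSubgroup o v) {c : ℂ} (hc : U.mat = c • 1) : c = 1 := by
  have h1 : oriented o U.mat = c • 1 := by
    rw [hc]
    cases o
    · rfl
    · change (c • 1 : Matrix (ι → ZMod 2) (ι → ZMod 2) ℂ)ᵀ = _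
      rw [Matrix.transpose_smul, Matrix.transpose_one]
  rw [mem_fixingSubgroup, h1, Matrix.smul_mulVec, Matrix.one_mulVec] at hU
  exact smul_left_injective ℂ hv (hU.trans (one_smul ℂ v).symm)

theorem eq_one_of_mem_fixingSubgroup {o : Bool} {v : (ι → ZMod 2) → ℂ} (hv : v ≠ 0)
    {U : PauliGroup ι} (hU : U ∈ fixingSubgroup o v) (hw : U.word = 0) : U = 1 := by
  obtain ⟨k, hk⟩ := exists_eq_phasedWord_word U
  have h1 : U.mat = Complex.I ^ k • 1 := by
    rw [hk, hw, mat_phasedWord, wordMatrix_zero]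
  have h2 := eq_one_of_mat_eq_smul_one hv hU h1
  rw [h2, one_smul] at h1
  exact PauliGroup.mat_injective h1

theorem eq_of_mem_fixingSubgroup {o : Bool} {v : (ι → ZMod 2) → ℂ} (hv : v ≠ 0)
    {U U' : PauliGroup ι} (hU : U ∈ fixingSubgroup o v) (hU' : U' ∈ fixingSubgroup o v)
    (hw : U.word = U'.word) : U = U' := by
  refine eq_of_mul_inv_eq_one (eq_one_of_mem_fixingSubgroup hv
    ((fixingSubgroup o v).mul_mem hU ((fixingSubgroup o v).inv_mem hU')) ?_)
  rw [PauliGroup.word_mul, PauliGroup.word_inv, hw, add_neg_cancel]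

end Lagrangian

/-! ## Pauli operators on inputs and outputs -/

section Bipartite

variable {n m : ℕ}

theorem inputHom_phasedWord (k : ℕ) (w : Fin n → Color) :
    inputHom n m (phasedWord k w) = phasedWord k (Sum.elim w 0) :=
  Subtype.ext (matrixInl_word k w)

theorem outputHom_phasedWord (k : ℕ) (w : Fin m → Color) :
    outputHom n m (phasedWord k w) = phasedWord k (Sum.elim 0 w) :=
  Subtype.ext (matrixInr_word k w)

@[simp] theorem word_inputHom (a : PauliGroup (Fin n)) :
    (inputHom n m a).word = Sum.elim a.word (0 : Fin m → Color) := by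
  obtain ⟨k, h⟩ := exists_eq_phasedWord_word a
  conv_lhs => rw [h]
  rw [inputHom_phasedWord, word_phasedWord]

@[simp] theorem word_outputHom (b : PauliGroup (Fin m)) :
    (outputHom n m b).word = Sum.elim (0 : Fin n → Color) b.word := by
  obtain ⟨k, h⟩ := exists_eq_phasedWord_word b
  conv_lhs => rw [h]
  rw [outputHom_phasedWord, word_phasedWord]

theorem mem_range_inputHom {U : PauliGroup (Fin n ⊕ Fin m)} :
    U ∈ (inputHom n m).range ↔ ∀ j, U.word (Sum.inr j) = 0 := by
  constructor
  · rintro ⟨a, rfl⟩ j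
    simp
  · intro h
    obtain ⟨k, hk⟩ := exists_eq_phasedWord_word U
    refine ⟨phasedWord k fun i => U.word (Sum.inl i), ?_⟩
    rw [inputHom_phasedWord, hk, word_phasedWord]
    congr 1
    funext i
    rcases i with i | j
    · rfl
    · exact (h j).symm

theorem mem_range_outputHom {U : PauliGroup (Fin n ⊕ Fin m)} :
    U ∈ (outputHom n m).range ↔ ∀ i, U.word (Sum.inl i) = 0 := by
  constructor
  · rintro ⟨a, rfl⟩ j
    simp
  · intro h
    obtain ⟨k, hk⟩ := exists_eq_phasedWord_word U
    refine ⟨phasedWord k fun i => U.word (Sum.inr i), ?_⟩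
    rw [outputHom_phasedWord, hk, word_phasedWord]
    congr 1
    funext i
    rcases i with i | j
    · exact (h i).symm
    · rfl

theorem wordForm_sum (u v : Fin n ⊕ Fin m → Color) :
    wordForm _ u v = wordForm (Fin n) (fun i => u (Sum.inl i)) (fun i => v (Sum.inl i))
      + wordForm (Fin m) (fun j => u (Sum.inr j)) (fun j => v (Sum.inr j)) := by
  simp only [wordForm_apply, Fintype.sum_sum_type]

theorem inputHom_mul_outputHom_comm (a : PauliGroup (Fin n)) (b : PauliGroup (Fin m)) :
    inputHom n m a * outputHom n m b = outputHom n m b * inputHom n m a := by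
  rw [PauliGroup.commute_iff, wordForm_apply]
  simp [symp]

@[simp] theorem word_pauliTensor (a : PauliGroup (Fin n)) (b : PauliGroup (Fin m)) :
    (pauliTensor a b).word = Sum.elim a.word b.word := by
  rw [pauliTensor, PauliGroup.word_mul, word_inputHom, word_outputHom]
  funext i
  rcases i with i | j <;> simp

theorem pauliTensor_mul (a a' : PauliGroup (Fin n)) (b b' : PauliGroup (Fin m)) :
    pauliTensor a b * pauliTensor a' b' = pauliTensor (a * a') (b * b') := by
  simp only [pauliTensor, map_mul]
  rw [mul_assoc, ← mul_assoc (outputHom n m b), ← inputHom_mul_outputHom_comm]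
  simp only [mul_assoc]

theorem pauliTensor_one_right (a : PauliGroup (Fin n)) :
    pauliTensor a (1 : PauliGroup (Fin m)) = inputHom n m a := by
  rw [pauliTensor, map_one, mul_one]

theorem pauliTensor_one_left (b : PauliGroup (Fin m)) :
    pauliTensor (1 : PauliGroup (Fin n)) b = outputHom n m b := by
  rw [pauliTensor, map_one, one_mul]

theorem pauliTensor_inv (a : PauliGroup (Fin n)) (b : PauliGroup (Fin m)) :
    (pauliTensor a b)⁻¹ = pauliTensor a⁻¹ b⁻¹ := by
  refine inv_eq_of_mul_eq_one_right ?_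
  rw [pauliTensor_mul, mul_inv_cancel, mul_inv_cancel, pauliTensor_one_right, map_one]

theorem exists_pauliTensor_right {U : PauliGroup (Fin n ⊕ Fin m)} {a : PauliGroup (Fin n)}
    (h : ∀ i, U.word (Sum.inl i) = a.word i) : ∃ b, U = pauliTensor a b := by
  have h1 : (inputHom n m a)⁻¹ * U ∈ (outputHom n m).range :=
    mem_range_outputHom.2 fun i => by simp [h]
  obtain ⟨b, hb⟩ := h1
  exact ⟨b, by rw [pauliTensor, hb, mul_inv_cancel_left]⟩

theorem exists_pauliTensor_left {U : PauliGroup (Fin n ⊕ Fin m)} {b : PauliGroup (Fin m)}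
    (h : ∀ j, U.word (Sum.inr j) = b.word j) : ∃ a, U = pauliTensor a b := by
  have h1 : U * (outputHom n m b)⁻¹ ∈ (inputHom n m).range :=
    mem_range_inputHom.2 fun i => by simp [h]
  obtain ⟨a, ha⟩ := h1
  exact ⟨a, by rw [pauliTensor, ha, inv_mul_cancel_right]⟩

theorem mat_pauliTensor (a : PauliGroup (Fin n)) (b : PauliGroup (Fin m)) :
    (pauliTensor a b).mat = (a.mat ⊗ₖ b.mat).submatrix
      (Equiv.sumArrowEquivProdArrow _ _ _) (Equiv.sumArrowEquivProdArrow _ _ _) := by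
  change matrixInl a.mat * matrixInr b.mat = _
  simp only [matrixInl, matrixInr, MonoidHom.coe_mk, OneHom.coe_mk]
  rw [Matrix.submatrix_mul_equiv, ← Matrix.mul_kronecker_mul, one_mul, mul_one]

theorem oriented_pauliTensor (o : Bool) (a : PauliGroup (Fin n)) (b : PauliGroup (Fin m)) :
    oriented o (pauliTensor a b).mat = (oriented o a.mat ⊗ₖ oriented o b.mat).submatrix
      (Equiv.sumArrowEquivProdArrow _ _ _) (Equiv.sumArrowEquivProdArrow _ _ _) := by
  rw [mat_pauliTensor]
  cases o
  · rfl
  · rfl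

theorem kronecker_mulVec_elim (A : Matrix (Fin n → ZMod 2) (Fin n → ZMod 2) ℂ)
    (B : Matrix (Fin m → ZMod 2) (Fin m → ZMod 2) ℂ) (v : (Fin n ⊕ Fin m → ZMod 2) → ℂ)
    (x : Fin n → ZMod 2) (y : Fin m → ZMod 2) :
    ((A ⊗ₖ B).submatrix (Equiv.sumArrowEquivProdArrow _ _ _)
      (Equiv.sumArrowEquivProdArrow _ _ _) *ᵥ v) (Sum.elim x y)
      = (B * Matrix.of (fun y x => v (Sum.elim x y)) * Aᵀ)
        y x := by
  rw [Matrix.mulVec, dotProduct, ← (Equiv.sumArrowEquivProdArrow _ _ _).symm.sum_comp,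
    Fintype.sum_prod_type, Matrix.mul_apply]
  refine Finset.sum_congr rfl fun x' _ => ?_
  rw [Matrix.mul_apply, Finset.sum_mul]
  refine Finset.sum_congr rfl fun y' _ => ?_
  rw [Matrix.submatrix_apply, Equiv.apply_symm_apply, Matrix.kroneckerMap_apply,
    Matrix.transpose_apply, Matrix.of_apply]
  change A x x' * B y y' * v (Sum.elim x' y') = _
  ring

theorem oriented_pauliTensor_mulVec_iff (T : Network n m) (o : Bool) (a : PauliGroup (Fin n))
    (b : PauliGroup (Fin m)) :
    oriented o (pauliTensor a b).mat *ᵥ T.eval = T.eval ↔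
      oriented o b.mat * T.linearMap * (oriented o a.mat)ᵀ = T.linearMap := by
  rw [oriented_pauliTensor]
  constructor
  · intro h
    ext y x
    refine (kronecker_mulVec_elim (oriented o a.mat) (oriented o b.mat) T.eval x y).symm.trans ?_
    rw [h]
    rfl
  · intro h
    funext z
    rw [← Sum.elim_comp_inl_inr z, kronecker_mulVec_elim]
    exact congrFun (congrFun h _) _

end Bipartite

/-! ## Normalizers and the logical isomorphism -/

namespace IsLagrangian

variable {n m : ℕ} {S : Subgroup (PauliGroup (Fin n ⊕ Fin m))}
  {Λ : Submodule (ZMod 2) (Fin n ⊕ Fin m → Color)}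

theorem mem_normalizer_inputStab (hS : IsLagrangian S Λ) {a : PauliGroup (Fin n)}
    {b : PauliGroup (Fin m)} (h : pauliTensor a b ∈ S) : a ∈ normalizerOf (inputStab S) := by
  refine Subgroup.centralizer_le_normalizer _ (Subgroup.mem_centralizer_iff.2 fun s hs => ?_)
  rw [PauliGroup.commute_iff]
  have h1 := (PauliGroup.commute_iff _ _).1 (hS.mul_comm (Subgroup.mem_comap.1 hs) h)
  rw [wordForm_sum] at h1
  simpa [wordForm_apply, symp] using h1

theorem mem_normalizer_outputStab (hS : IsLagrangian S Λ) {a : PauliGroup (Fin n)}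
    {b : PauliGroup (Fin m)} (h : pauliTensor a b ∈ S) : b ∈ normalizerOf (outputStab S) := by
  refine Subgroup.centralizer_le_normalizer _ (Subgroup.mem_centralizer_iff.2 fun s hs => ?_)
  rw [PauliGroup.commute_iff]
  have h1 := (PauliGroup.commute_iff _ _).1 (hS.mul_comm (Subgroup.mem_comap.1 hs) h)
  rw [wordForm_sum] at h1
  simpa [wordForm_apply, symp] using h1

theorem wordForm_inputHom_eq_zero (hS : IsLagrangian S Λ) {a s : PauliGroup (Fin n)}
    (ha : a ∈ normalizerOf (inputStab S)) (hs : s ∈ inputStab S) :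
    wordForm _ (inputHom n m s).word (inputHom n m a).word = 0 := by
  have h1 := Subgroup.mem_comap.1 ((Subgroup.mem_normalizer_iff.1 ha s).1 hs)
  have h2 := hS.eq_of_word_eq h1 (Subgroup.mem_comap.1 hs) (by simp)
  rw [map_mul, map_mul, map_inv, mul_inv_eq_iff_eq_mul] at h2
  exact (PauliGroup.commute_iff _ _).1 h2.symm

theorem wordForm_outputHom_eq_zero (hS : IsLagrangian S Λ) {b s : PauliGroup (Fin m)}
    (hb : b ∈ normalizerOf (outputStab S)) (hs : s ∈ outputStab S) :
    wordForm _ (outputHom n m s).word (outputHom n m b).word = 0 := by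
  have h1 := Subgroup.mem_comap.1 ((Subgroup.mem_normalizer_iff.1 hb s).1 hs)
  have h2 := hS.eq_of_word_eq h1 (Subgroup.mem_comap.1 hs) (by simp)
  rw [map_mul, map_mul, map_inv, mul_inv_eq_iff_eq_mul] at h2
  exact (PauliGroup.commute_iff _ _).1 h2.symm

end IsLagrangian

/-- The words that are trivial on the positions outside the image of `j`. -/
def supportedWords {ι κ : Type} (j : κ → ι) : Submodule (ZMod 2) (ι → Color) :=
  LinearMap.ker (LinearMap.funLeft (ZMod 2) Color j)

theorem mem_supportedWords {ι κ : Type} {j : κ → ι} {w : ι → Color} :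
    w ∈ supportedWords j ↔ ∀ i, w (j i) = 0 := by
  rw [supportedWords, LinearMap.mem_ker, funext_iff]
  rfl

theorem eq_zero_of_mem_orthogonal_supportedWords {ι κ : Type} [Fintype ι] [DecidableEq ι]
    {j : κ → ι} {w : ι → Color} (hw : w ∈ (wordForm ι).orthogonal (supportedWords j)) {i : ι}
    (hi : ∀ k, j k ≠ i) : w i = 0 := by
  have key : ∀ c : Color, (∀ d, symp c d = 0) → c = 0 := by decide
  refine key _ fun d => ?_
  rw [← wordForm_single, wordForm_isSymm.isRefl.eq_iff]
  exact mem_orthogonal_word.1 hw _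
    (mem_supportedWords.2 fun k => by rw [Pi.single_eq_of_ne (hi k)])

namespace IsLagrangian

variable {n m : ℕ} {S : Subgroup (PauliGroup (Fin n ⊕ Fin m))}
  {Λ : Submodule (ZMod 2) (Fin n ⊕ Fin m → Color)}

theorem exists_pauliTensor_mem_right (hS : IsLagrangian S Λ) {a : PauliGroup (Fin n)}
    (ha : a ∈ normalizerOf (inputStab S)) : ∃ b, pauliTensor a b ∈ S := by
  obtain ⟨U, hU, hUK⟩ := hS.exists_word_sub_mem (supportedWords Sum.inl)
    (x := (inputHom n m a).word) (by
      intro U hU hUK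
      obtain ⟨s, rfl⟩ := mem_range_inputHom.2 fun j =>
        eq_zero_of_mem_orthogonal_supportedWords hUK (i := Sum.inr j) (by simp)
      exact hS.wordForm_inputHom_eq_zero ha hU)
  obtain ⟨b, rfl⟩ := exists_pauliTensor_right (U := U) (a := a) fun i => by
    have := mem_supportedWords.1 hUK i
    rwa [Pi.sub_apply, sub_eq_zero, word_inputHom] at this
  exact ⟨b, hU⟩

theorem exists_pauliTensor_mem_left (hS : IsLagrangian S Λ) {b : PauliGroup (Fin m)}
    (hb : b ∈ normalizerOf (outputStab S)) : ∃ a, pauliTensor a b ∈ S := by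
  obtain ⟨U, hU, hUK⟩ := hS.exists_word_sub_mem (supportedWords Sum.inr)
    (x := (outputHom n m b).word) (by
      intro U hU hUK
      obtain ⟨s, rfl⟩ := mem_range_outputHom.2 fun j =>
        eq_zero_of_mem_orthogonal_supportedWords hUK (i := Sum.inl j) (by simp)
      exact hS.wordForm_outputHom_eq_zero hb hU)
  obtain ⟨a, rfl⟩ := exists_pauliTensor_left (U := U) (b := b) fun i => by
    have := mem_supportedWords.1 hUK i
    rwa [Pi.sub_apply, sub_eq_zero, word_outputHom] at this
  exact ⟨a, hU⟩

end IsLagrangian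

theorem logicalClass_eq_iff {ι : Type} [Fintype ι] [DecidableEq ι] {S : Subgroup (PauliGroup ι)}
    {x y : normalizerOf S} : logicalClass x = logicalClass y ↔ x.1⁻¹ * y.1 ∈ S := by
  rw [logicalClass, logicalClass, QuotientGroup.eq, Subgroup.mem_subgroupOf]
  rfl

section Logical

variable {n m : ℕ} {S : Subgroup (PauliGroup (Fin n ⊕ Fin m))}

theorem inv_mul_mem_outputStab {a : PauliGroup (Fin n)} {b b' : PauliGroup (Fin m)}
    (h : pauliTensor a b ∈ S) : b⁻¹ * b' ∈ outputStab S ↔ pauliTensor a b' ∈ S := by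
  rw [outputStab, Subgroup.mem_comap, ← pauliTensor_one_left, ← inv_mul_cancel a,
    ← pauliTensor_mul, ← pauliTensor_inv]
  exact S.mul_mem_cancel_left (S.inv_mem h)

theorem IsLogicalPart.notMem_range {L : Subgroup (PauliGroup (Fin n ⊕ Fin m))}
    (hL : IsLogicalPart S L) {U : PauliGroup (Fin n ⊕ Fin m)} (hU : U ∈ L) (h1 : U ≠ 1) :
    U ∉ (inputHom n m).range ∧ U ∉ (outputHom n m).range := by
  obtain ⟨hLS, -, hinf⟩ := hL
  have key : U ∉ inputPart S ⊔ outputPart S := fun h => h1 <| by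
    have h2 : U ∈ L ⊓ (inputPart S ⊔ outputPart S) := ⟨hU, h⟩
    rwa [hinf, Subgroup.mem_bot] at h2
  exact ⟨fun h => key (Subgroup.mem_sup_left ⟨hLS hU, h⟩),
    fun h => key (Subgroup.mem_sup_right ⟨hLS hU, h⟩)⟩

namespace IsLagrangian

variable {Λ : Submodule (ZMod 2) (Fin n ⊕ Fin m → Color)}

theorem exists_partner (hS : IsLagrangian S Λ) (a : normalizerOf (inputStab S)) :
    ∃ b : normalizerOf (outputStab S), pauliTensor a.1 b.1 ∈ S := by
  obtain ⟨b, hb⟩ := hS.exists_pauliTensor_mem_right a.2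
  exact ⟨⟨b, hS.mem_normalizer_outputStab hb⟩, hb⟩

theorem exists_logicalHom (hS : IsLagrangian S Λ) :
    ∃ ψ : normalizerOf (inputStab S) →* LogicalPauli (outputStab S),
      ∀ a b, ψ a = logicalClass b ↔ pauliTensor a.1 b.1 ∈ S := by
  choose β hβ using hS.exists_partner
  have key : ∀ a b, logicalClass (β a) = logicalClass b ↔ pauliTensor a.1 b.1 ∈ S := fun a b => by
    rw [logicalClass_eq_iff, inv_mul_mem_outputStab (hβ a)]
  refine ⟨MonoidHom.mk' (fun a => logicalClass (β a)) fun a a' => ?_, key⟩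
  refine (key _ (β a * β a')).2 ?_
  rw [Subgroup.coe_mul, Subgroup.coe_mul, ← pauliTensor_mul]
  exact S.mul_mem (hβ a) (hβ a')

theorem exists_logicalEquiv (hS : IsLagrangian S Λ) :
    ∃ φ : LogicalPauli (inputStab S) ≃* LogicalPauli (outputStab S),
      ∀ a b, φ (logicalClass a) = logicalClass b ↔ pauliTensor a.1 b.1 ∈ S := by
  obtain ⟨ψ, hψ⟩ := hS.exists_logicalHom
  have h1 : (logicalClass (1 : normalizerOf (outputStab S))) = 1 := rfl
  have hker : ∀ a, ψ a = 1 ↔ a.1 ∈ inputStab S := fun a => by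
    rw [← h1, hψ, Subgroup.coe_one, pauliTensor_one_right]
    rfl
  let φ : LogicalPauli (inputStab S) →* LogicalPauli (outputStab S) :=
    QuotientGroup.lift _ ψ fun a ha => (hker a).2 (Subgroup.mem_subgroupOf.1 ha)
  have hφ : ∀ a, φ (logicalClass a) = ψ a := fun a => rfl
  refine ⟨MulEquiv.ofBijective φ ⟨?_, ?_⟩, fun a b => ?_⟩
  · refine (injective_iff_map_eq_one φ).2 fun c hc => ?_
    obtain ⟨a, rfl⟩ := QuotientGroup.mk_surjective c
    exact (QuotientGroup.eq_one_iff a).2 (Subgroup.mem_subgroupOf.2 ((hker a).1 hc))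
  · intro d
    obtain ⟨b, rfl⟩ := QuotientGroup.mk_surjective d
    obtain ⟨a, ha⟩ := hS.exists_pauliTensor_mem_left b.2
    exact ⟨logicalClass ⟨a, hS.mem_normalizer_inputStab ha⟩, (hψ ⟨a, _⟩ b).2 ha⟩
  · exact hψ a b

/-! ## Logical stabilizer groups -/

theorem exists_isLogicalPart (hS : IsLagrangian S Λ) : ∃ L, IsLogicalPart S L := by
  let Λin := Λ ⊓ supportedWords (Sum.inr : Fin m → Fin n ⊕ Fin m)
  let Λout := Λ ⊓ supportedWords (Sum.inl : Fin n → Fin n ⊕ Fin m)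
  have hM : Λin ⊔ Λout ≤ Λ := sup_le inf_le_left inf_le_left
  obtain ⟨C, hC⟩ := exists_isCompl (Λin ⊔ Λout)
  have hsup : (Λin ⊔ Λout) ⊔ C ⊓ Λ = Λ := by
    rw [← sup_inf_assoc_of_le C hM, hC.sup_eq_top, top_inf_eq]
  have hle : inputPart S ⊔ outputPart S ≤ wordSubgroup (Λin ⊔ Λout) := by
    refine sup_le ?_ ?_
    · rintro U ⟨hU, hr⟩
      exact Submodule.mem_sup_left
        ⟨hS.word_mem hU, mem_supportedWords.2 (mem_range_inputHom.1 hr)⟩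
    · rintro U ⟨hU, hr⟩
      exact Submodule.mem_sup_right
        ⟨hS.word_mem hU, mem_supportedWords.2 (mem_range_outputHom.1 hr)⟩
  refine ⟨S ⊓ wordSubgroup C, inf_le_left, le_antisymm ?_ fun U hU => ?_, ?_⟩
  · exact sup_le (sup_le inf_le_left inf_le_left) inf_le_left
  · have h1 : U.word ∈ (Λin ⊔ Λout) ⊔ C ⊓ Λ := by
      rw [hsup]
      exact hS.word_mem hU
    obtain ⟨y, hy, z, ⟨hzC, hz⟩, hyz⟩ := Submodule.mem_sup.1 h1
    obtain ⟨u, ⟨hu, hu'⟩, v, ⟨hv, hv'⟩, rfl⟩ := Submodule.mem_sup.1 hy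
    obtain ⟨U₁, h1, rfl⟩ := (hS.mem_iff u).1 hu
    obtain ⟨U₂, h2, rfl⟩ := (hS.mem_iff v).1 hv
    obtain ⟨U₃, h3, rfl⟩ := (hS.mem_iff z).1 hz
    have hprod : U = U₁ * U₂ * U₃ :=
      hS.eq_of_word_eq hU (S.mul_mem (S.mul_mem h1 h2) h3) (by simp [hyz])
    rw [hprod]
    refine mul_mem (Subgroup.mem_sup_left (mul_mem (Subgroup.mem_sup_left ?_)
      (Subgroup.mem_sup_right ?_))) (Subgroup.mem_sup_right ⟨h3, hzC⟩)
    · exact ⟨h1, mem_range_inputHom.2 (mem_supportedWords.1 hu')⟩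
    · exact ⟨h2, mem_range_outputHom.2 (mem_supportedWords.1 hv')⟩
  · refine eq_bot_iff.2 fun U hU => Subgroup.mem_bot.2 ?_
    obtain ⟨⟨hUS, hUC⟩, hU'⟩ := hU
    refine hS.eq_one_of_word_eq_zero hUS ?_
    have h1 : U.word ∈ (Λin ⊔ Λout) ⊓ C := ⟨hle hU', hUC⟩
    rwa [hC.inf_eq_bot, Submodule.mem_bot] at h1

theorem inputPart_inf_outputPart (hS : IsLagrangian S Λ) {U : PauliGroup (Fin n ⊕ Fin m)}
    (h : U ∈ inputPart S) (h' : U ∈ outputPart S) : U = 1 := by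
  refine hS.eq_one_of_word_eq_zero h.1 (funext fun i => ?_)
  rcases i with i | j
  · exact mem_range_outputHom.1 h'.2 i
  · exact mem_range_inputHom.1 h.2 j

theorem exists_mulEquiv_of_isLogicalPart (hS : IsLagrangian S Λ)
    {L : Subgroup (PauliGroup (Fin n ⊕ Fin m))} (hL : IsLogicalPart S L) :
    ∃ e : inputPart S × outputPart S × L ≃* S,
      ∀ q, (e q : PauliGroup (Fin n ⊕ Fin m)) = q.1 * q.2.1 * q.2.2 := by
  obtain ⟨hLS, hgen, hinf⟩ := hL
  let _ : CommGroup S :=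
    { (inferInstance : Group S) with
      mul_comm := fun x y => Subtype.ext (hS.mul_comm x.2 y.2) }
  let e : inputPart S × outputPart S × L →* S :=
    (Subgroup.inclusion (inf_le_left : inputPart S ≤ S)).coprod
      ((Subgroup.inclusion (inf_le_left : outputPart S ≤ S)).coprod (Subgroup.inclusion hLS))
  have he : ∀ q, (e q : PauliGroup (Fin n ⊕ Fin m)) = q.1 * q.2.1 * q.2.2 := fun q =>
    (mul_assoc _ _ _).symm
  refine ⟨MulEquiv.ofBijective e ⟨?_, ?_⟩, he⟩
  · refine (injective_iff_map_eq_one e).2 ?_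
    rintro ⟨s, t, l⟩ h
    have h1 : (s * t * l : PauliGroup (Fin n ⊕ Fin m)) = 1 := by
      rw [← he (s, t, l), h]
      rfl
    have hst : (s * t : PauliGroup (Fin n ⊕ Fin m)) ∈ inputPart S ⊔ outputPart S :=
      mul_mem (Subgroup.mem_sup_left s.2) (Subgroup.mem_sup_right t.2)
    have hl : (l : PauliGroup (Fin n ⊕ Fin m)) = 1 := by
      have h2 : (l : PauliGroup (Fin n ⊕ Fin m)) ∈ L ⊓ (inputPart S ⊔ outputPart S) := by
        refine ⟨l.2, ?_⟩
        rw [← inv_eq_of_mul_eq_one_right h1]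
        exact (inputPart S ⊔ outputPart S).inv_mem hst
      rwa [hinf, Subgroup.mem_bot] at h2
    rw [hl, mul_one] at h1
    have ht : (t : PauliGroup (Fin n ⊕ Fin m)) = 1 := by
      refine hS.inputPart_inf_outputPart ?_ t.2
      rw [← inv_eq_of_mul_eq_one_right h1]
      exact (inputPart S).inv_mem s.2
    rw [ht, mul_one] at h1
    exact Prod.ext (Subtype.ext h1) (Prod.ext (Subtype.ext ht) (Subtype.ext hl))
  · have hle : S ≤ e.range.map S.subtype := by
      conv_lhs => rw [← hgen]
      refine sup_le (sup_le ?_ ?_) ?_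
      · intro U hU
        exact ⟨e (⟨U, hU⟩, 1, 1), ⟨_, rfl⟩, by simp [he]⟩
      · intro U hU
        exact ⟨e (1, ⟨U, hU⟩, 1), ⟨_, rfl⟩, by simp [he]⟩
      · intro U hU
        exact ⟨e (1, 1, ⟨U, hU⟩), ⟨_, rfl⟩, by simp [he]⟩
    intro U
    obtain ⟨V, ⟨q, hq⟩, hV⟩ := hle U.2
    exact ⟨q, hq.trans (Subtype.ext hV)⟩

theorem exists_representative (hS : IsLagrangian S Λ)
    {L : Subgroup (PauliGroup (Fin n ⊕ Fin m))} (hL : IsLogicalPart S L)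
    (c : LogicalPauli (inputStab S)) :
    ∃ (a : normalizerOf (inputStab S)) (b : normalizerOf (outputStab S)),
      pauliTensor a.1 b.1 ∈ L ∧ c = logicalClass a := by
  obtain ⟨e, he⟩ := hS.exists_mulEquiv_of_isLogicalPart hL
  obtain ⟨a, rfl⟩ := QuotientGroup.mk_surjective c
  obtain ⟨b, hab⟩ := hS.exists_partner a
  obtain ⟨⟨⟨U₁, h1S, s, rfl⟩, ⟨U₂, h2S, t, rfl⟩, l⟩, hq⟩ := e.surjective ⟨_, hab⟩
  have h1 : pauliTensor a.1 b.1 = pauliTensor s t * l := by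
    have h2 := he (⟨_, h1S, s, rfl⟩, ⟨_, h2S, t, rfl⟩, l)
    rw [hq] at h2
    exact h2
  have h2 : pauliTensor (s⁻¹ * a.1) (t⁻¹ * b.1) = l := by
    rw [← pauliTensor_mul, ← pauliTensor_inv, h1, inv_mul_cancel_left]
  have h3 : pauliTensor (s⁻¹ * a.1) (t⁻¹ * b.1) ∈ L := h2 ▸ l.2
  have h4 := hL.1 h3
  refine ⟨⟨s⁻¹ * a.1, hS.mem_normalizer_inputStab h4⟩,
    ⟨t⁻¹ * b.1, hS.mem_normalizer_outputStab h4⟩, h3, ?_⟩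
  have hs : s ∈ inputStab S := h1S
  refine (logicalClass_eq_iff (x := a)).2 ?_
  exact (Subgroup.mem_normalizer_iff''.1 a.2 s⁻¹).1 (inv_mem hs) |> fun h => by
    simpa only [mul_assoc] using h

end IsLagrangian

end Logical

/-! ## The stabilizer group of a network -/

namespace Network

variable {n m : ℕ} (T : Network n m)

theorem signedPauli_mem_fixingSubgroup (o : Bool) (f : T.flows) :
    T.signedPauli o f ∈ fixingSubgroup o T.eval := T.oriented_signedPauli_mulVec o f

theorem signedPauli_add (hT : T.eval ≠ 0) (o : Bool) (f g : T.flows) :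
    T.signedPauli o (f + g) = T.signedPauli o f * T.signedPauli o g := by
  refine eq_of_mem_fixingSubgroup hT (T.signedPauli_mem_fixingSubgroup o _)
    (mul_mem (T.signedPauli_mem_fixingSubgroup o f) (T.signedPauli_mem_fixingSubgroup o g)) ?_
  rw [PauliGroup.word_mul]
  simp only [word_signedPauli]
  rfl

theorem signedPauli_eq_one_iff (hT : T.eval ≠ 0) (o : Bool) (f : T.flows) :
    T.signedPauli o f = 1 ↔ f ∈ T.detectorFlows := by
  rw [detectorFlows_eq_ker, AddMonoidHom.mem_ker, openHom_apply, ← T.word_signedPauli o]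
  exact ⟨fun h => by rw [h, PauliGroup.word_one],
    eq_one_of_mem_fixingSubgroup hT (T.signedPauli_mem_fixingSubgroup o f)⟩

/-- The homomorphism from Pauli flows modulo detector flows to Pauli operators. -/
noncomputable def flowHom (hT : T.eval ≠ 0) (o : Bool) :
    Multiplicative (T.flows ⧸ T.detectorFlows) →* PauliGroup (Fin n ⊕ Fin m) :=
  AddMonoidHom.toMultiplicativeLeft (QuotientAddGroup.lift T.detectorFlows
    (AddMonoidHom.mk' (fun f => Additive.ofMul (T.signedPauli o f)) fun f g => by
      rw [T.signedPauli_add hT]; rfl)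
    fun f hf => (T.signedPauli_eq_one_iff hT o f).2 hf)

theorem flowHom_mk (hT : T.eval ≠ 0) (o : Bool) (f : T.flows) :
    T.flowHom hT o (Multiplicative.ofAdd (QuotientAddGroup.mk f)) = T.signedPauli o f := rfl

theorem mem_range_flowHom (hT : T.eval ≠ 0) (o : Bool) {U : PauliGroup (Fin n ⊕ Fin m)} :
    U ∈ (T.flowHom hT o).range ↔ ∃ f, T.signedPauli o f = U := by
  constructor
  · rintro ⟨x, rfl⟩
    obtain ⟨f, hf⟩ := QuotientAddGroup.mk_surjective (Multiplicative.toAdd x)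
    exact ⟨f, by rw [← T.flowHom_mk hT, hf]; rfl⟩
  · rintro ⟨f, rfl⟩
    exact ⟨_, T.flowHom_mk hT o f⟩

theorem flowHom_injective (hT : T.eval ≠ 0) (o : Bool) :
    Function.Injective (T.flowHom hT o) := by
  refine (injective_iff_map_eq_one _).2 fun x hx => ?_
  obtain ⟨f, hf⟩ := QuotientAddGroup.mk_surjective (Multiplicative.toAdd x)
  obtain rfl : x = Multiplicative.ofAdd (QuotientAddGroup.mk f) := by rw [hf]; rfl
  rw [flowHom_mk, signedPauli_eq_one_iff T hT] at hx
  exact congrArg Multiplicative.ofAdd ((QuotientAddGroup.eq_zero_iff f).2 hx)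

theorem range_flowHom_le (hT : T.eval ≠ 0) (o : Bool) :
    (T.flowHom hT o).range ≤ fixingSubgroup o T.eval := by
  intro U hU
  obtain ⟨f, rfl⟩ := (T.mem_range_flowHom hT o).1 hU
  exact T.signedPauli_mem_fixingSubgroup o f

theorem isLagrangian_range_flowHom (hT : T.eval ≠ 0) (o : Bool) :
    IsLagrangian (T.flowHom hT o).range T.openWords where
  orthogonal_eq := T.orthogonal_openWords
  mem_iff w := by
    rw [mem_openWords]
    constructor
    · rintro ⟨f, rfl⟩
      exact ⟨_, (T.mem_range_flowHom hT o).2 ⟨f, rfl⟩, T.word_signedPauli o f⟩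
    · rintro ⟨U, hU, rfl⟩
      obtain ⟨f, rfl⟩ := (T.mem_range_flowHom hT o).1 hU
      exact ⟨f, (T.word_signedPauli o f).symm⟩
  eq_of_word_eq hU hU' h :=
    eq_of_mem_fixingSubgroup hT (T.range_flowHom_le hT o hU) (T.range_flowHom_le hT o hU') h

theorem range_flowHom (hT : T.eval ≠ 0) (o : Bool) :
    (T.flowHom hT o).range = fixingSubgroup o T.eval := by
  refine le_antisymm (T.range_flowHom_le hT o) fun U hU => ?_
  have hS := T.isLagrangian_range_flowHom hT o
  have h1 : U.word ∈ T.openWords := by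
    rw [← T.orthogonal_openWords, mem_orthogonal_word]
    intro u hu
    obtain ⟨V, hV, rfl⟩ := (hS.mem_iff u).1 hu
    have hV' := T.range_flowHom_le hT o hV
    exact (PauliGroup.commute_iff V U).1 (eq_of_mem_fixingSubgroup hT (mul_mem hV' hU)
      (mul_mem hU hV') (by simp [add_comm]))
  obtain ⟨V, hV, hVU⟩ := (hS.mem_iff _).1 h1
  rwa [← eq_of_mem_fixingSubgroup hT (T.range_flowHom_le hT o hV) hU hVU]

theorem mem_range_flowHom_iff_fixes (hT : T.eval ≠ 0) (o : Bool)
    {U : PauliGroup (Fin n ⊕ Fin m)} :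
    U ∈ (T.flowHom hT o).range ↔ oriented o U.mat *ᵥ T.eval = T.eval := by
  rw [range_flowHom]
  exact mem_fixingSubgroup

theorem card_range_flowHom (hT : T.eval ≠ 0) (o : Bool) :
    Nat.card (T.flowHom hT o).range = 2 ^ (n + m) := by
  have hS := T.isLagrangian_range_flowHom hT o
  rw [← T.card_openWords]
  refine Nat.card_eq_of_bijective (fun U => ⟨_, hS.word_mem U.2⟩) ⟨?_, ?_⟩
  · intro U U' h
    exact Subtype.ext (hS.eq_of_word_eq U.2 U'.2 (congrArg Subtype.val h))
  · rintro ⟨u, hu⟩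
    obtain ⟨U, hU, rfl⟩ := (hS.mem_iff u).1 hu
    exact ⟨⟨U, hU⟩, rfl⟩

theorem isStabilizerGroup_range_flowHom (hT : T.eval ≠ 0) (o : Bool) :
    IsStabilizerGroup (T.flowHom hT o).range := by
  refine ⟨fun U hU U' hU' => (T.isLagrangian_range_flowHom hT o).mul_comm hU hU',
    fun U hU h => ?_⟩
  have h1 := eq_one_of_mat_eq_smul_one hT (T.range_flowHom_le hT o hU) (c := -1)
    (by rw [h, neg_one_smul])
  norm_num at h1

end Network

end RGB

theorem mainTheorem5 {n m : ℕ} (T : RGB.Network n m) (hT : T.eval ≠ 0) (o : Bool) :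
    ∃ p : Multiplicative (T.flows ⧸ T.detectorFlows) →* RGB.PauliGroup (Fin n ⊕ Fin m),
      (∀ f : T.flows,
        (p (Multiplicative.ofAdd (QuotientAddGroup.mk f))).mat
          = (-1 : ℂ) ^ (T.sgn o f).val • (T.unsignedPauli f).mat) ∧
      Function.Injective p ∧
      RGB.IsStabilizerGroup p.range ∧
      Nat.card p.range = 2 ^ (n + m) ∧
      (∀ U : RGB.PauliGroup (Fin n ⊕ Fin m),
        U ∈ p.range ↔ (RGB.oriented o U.mat).mulVec T.eval = T.eval) ∧
      (∃ L, RGB.IsLogicalPart p.range L) ∧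
      ∃ φ : RGB.LogicalPauli (RGB.inputStab p.range) ≃*
          RGB.LogicalPauli (RGB.outputStab p.range),
        (∀ a b, RGB.pauliTensor a b ∈ p.range →
          a ∈ RGB.normalizerOf (RGB.inputStab p.range) ∧
          b ∈ RGB.normalizerOf (RGB.outputStab p.range)) ∧
        (∀ (a : RGB.normalizerOf (RGB.inputStab p.range))
            (b : RGB.normalizerOf (RGB.outputStab p.range)),
          (φ (RGB.logicalClass a) = RGB.logicalClass b ↔
            RGB.pauliTensor a.1 b.1 ∈ p.range) ∧
          (φ (RGB.logicalClass a) = RGB.logicalClass b ↔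
            RGB.oriented o b.1.mat * T.linearMap * (RGB.oriented o a.1.mat).transpose
              = T.linearMap)) ∧
        ∀ L, RGB.IsLogicalPart p.range L →
          (∃ e : RGB.inputPart p.range × RGB.outputPart p.range × L ≃* p.range,
            ∀ q, (e q : RGB.PauliGroup (Fin n ⊕ Fin m)) = q.1 * q.2.1 * q.2.2) ∧
          (∀ U ∈ L, U ≠ 1 →
            U ∉ (RGB.inputHom n m).range ∧ U ∉ (RGB.outputHom n m).range) ∧
          ∀ c : RGB.LogicalPauli (RGB.inputStab p.range),
            ∃ (a : RGB.normalizerOf (RGB.inputStab p.range))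
              (b : RGB.normalizerOf (RGB.outputStab p.range)),
              RGB.pauliTensor a.1 b.1 ∈ L ∧
              c = RGB.logicalClass a ∧ φ c = RGB.logicalClass b := by
  have hS := T.isLagrangian_range_flowHom hT o
  obtain ⟨φ, hφ⟩ := hS.exists_logicalEquiv
  refine ⟨T.flowHom hT o, fun f => T.mat_signedPauli o f, T.flowHom_injective hT o,
    T.isStabilizerGroup_range_flowHom hT o, T.card_range_flowHom hT o,
    fun U => T.mem_range_flowHom_iff_fixes hT o, hS.exists_isLogicalPart, φ,
    fun a b h => ⟨hS.mem_normalizer_inputStab h, hS.mem_normalizer_outputStab h⟩,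
    fun a b => ⟨hφ a b, ?_⟩, fun L hL => ⟨hS.exists_mulEquiv_of_isLogicalPart hL,
      fun U hU h1 => hL.notMem_range hU h1, fun c => ?_⟩⟩
  · rw [hφ, ← RGB.oriented_pauliTensor_mulVec_iff, T.mem_range_flowHom_iff_fixes hT o]
  · obtain ⟨a, b, hab, hc⟩ := hS.exists_representative hL c
    exact ⟨a, b, hab, hc, by rw [hc]; exact (hφ a b).2 (hL.1 hab)⟩
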